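/- Let $M$ be a smooth, connected, finite-dimensional manifold, and let $X_1,\dots,X_N$ be smooth vector fields on $M$ that are bracket-generating, i.e. the Lie algebra they generate, evaluated at each point $x$, is $T_xM$. Put $\mathcal D_x=\mathrm{span}\{X_1(x),\dots,X_N(x)\}$, with norm $\|v\|_g=\inf\{(\sum_i u_i^2)^{1/2} : \sum_i u_iX_i(x)=v\}$ for $v\in\mathcal D_x$. A curve $\gamma:[0,T]\to M$ is horizontal if it is absolutely continuous and $\dot\gamma(t)=\sum_i u_i(t)X_i(\gamma(t))$ for a.e. $t$, for some $u\in L^2([0,T],\mathbb R^N)$. Its length is $\int_0^T\|\dot\gamma(t)\|_g\,dt$, and the sub-Riemannian distance $d_{\mathrm{SR}}(x,y)$ is the infimum of the lengths of the horizontal curves from $x$ to $y$. Let $\tilde X_1,\dots,\tilde X_L$ be smooth vector fields on $M$ that span $T_xM$ at every $x\in M$. For $\varepsilon\in\mathbb R$ let $d_\varepsilon$ be the distance defined in the same way from the family $X_1,\dots,X_N,\varepsilon\tilde X_1,\dots,\varepsilon\tilde X_L$ (for $\varepsilon\neq0$ this is the distance of a Riemannian metric $g_\varepsilon$, and $d_0=d_{\mathrm{SR}}$).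 Let $\Omega\subset M$ be an open relatively compact set with smooth boundary (near each of its boundary points, $\Omega$ is the set $\{f<0\}$ for a smooth function $f$ with $df\neq0$ at that point), and assume that $\partial\Omega$ has no characteristic points, i.e. $\mathcal D_x\not\subseteq T_x(\partial\Omega)$ for all $x\in\partial\Omega$. Let $\delta(x)=\inf_{z\in\partial\Omega}d_{\mathrm{SR}}(z,x)$ and $\delta_\varepsilon(x)=\inf_{z\in\partial\Omega}d_\varepsilon(z,x)$ for $x\in\bar\Omega$, and fix $\bar\varepsilon>0$. Then there exists a relatively open neighbourhood $U\subset\bar\Omega$ of $\partial\Omega$ in $\bar\Omega$ on which $\delta$ and $\delta_\varepsilon$, for all $|\varepsilon|<\bar\varepsilon$, are finite and smooth (up to the boundary $\partial\Omega$), and such that $\delta_\varepsilon\to\delta$ as $\varepsilon\to0$, uniformly on the compact subsets of $U$ together with all derivatives. -/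

import Mathlib

open Set Filter MeasureTheory
open scoped Manifold Topology ContDiff ENNReal

noncomputable section

namespace SubRiem

variable {E : Type*} [NormedAddCommGroup E] [NormedSpace ℝ E]
variable {M : Type*} [TopologicalSpace M] [ChartedSpace E M]
variable {ι : Type*}

/-! ### Sub-Riemannian structures given by a generating frame -/

/-- `V` is a smooth vector field on `M`. -/
def IsSmoothField [IsManifold 𝓘(ℝ, E) ∞ M] (V : (x : M) → TangentSpace 𝓘(ℝ, E) x) : Prop :=
  ContMDiff 𝓘(ℝ, E) 𝓘(ℝ, E).tangent ∞ (fun x => (⟨x, V x⟩ : TangentBundle 𝓘(ℝ, E) M))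

/-- The distribution `𝓓_x = span {X₁(x), …, X_N(x)} ⊆ T_x M`. -/
def distribution (X : ι → (x : M) → TangentSpace 𝓘(ℝ, E) x) (x : M) :
    Submodule ℝ (TangentSpace 𝓘(ℝ, E) x) :=
  Submodule.span ℝ (Set.range fun i => X i x)

/-- Membership in the real Lie algebra of vector fields generated by the family `X`. -/
inductive LieGenerated (X : ι → (x : M) → TangentSpace 𝓘(ℝ, E) x) :
    ((x : M) → TangentSpace 𝓘(ℝ, E) x) → Prop
  | of (i : ι) : LieGenerated X (X i)
  | zero : LieGenerated X (fun _ => 0)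
  | add {V W : (x : M) → TangentSpace 𝓘(ℝ, E) x} :
      LieGenerated X V → LieGenerated X W → LieGenerated X (fun x => V x + W x)
  | smul (c : ℝ) {V : (x : M) → TangentSpace 𝓘(ℝ, E) x} :
      LieGenerated X V → LieGenerated X (fun x => c • V x)
  | bracket {V W : (x : M) → TangentSpace 𝓘(ℝ, E) x} :
      LieGenerated X V → LieGenerated X W →
        LieGenerated X (VectorField.mlieBracket 𝓘(ℝ, E) V W)

/-- The generated Lie algebra, evaluated at any point `x`, is all of `T_x M`. -/
def BracketGenerating (X : ι → (x : M) → TangentSpace 𝓘(ℝ, E) x) : Prop :=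
  ∀ (x : M) (v : TangentSpace 𝓘(ℝ, E) x), ∃ V, LieGenerated X V ∧ V x = v

/-- `X` is a generating frame of a (possibly rank-varying) sub-Riemannian structure on `M`. -/
structure IsSubRiemannianFrame [IsManifold 𝓘(ℝ, E) ∞ M]
    (X : ι → (x : M) → TangentSpace 𝓘(ℝ, E) x) : Prop where
  smooth : ∀ i, IsSmoothField (X i)
  bracketGenerating : BracketGenerating X

/-- `Y` is a generating frame of a Riemannian structure: smooth fields spanning `T_x M`
at every point. -/
structure IsRiemannianFrame [IsManifold 𝓘(ℝ, E) ∞ M]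
    (Y : ι → (x : M) → TangentSpace 𝓘(ℝ, E) x) : Prop where
  smooth : ∀ i, IsSmoothField (Y i)
  spanning : ∀ x, distribution Y x = ⊤

/-- The family `{X₁, …, X_N, ε Y₁, …, ε Y_L}` that generates the `ε`-Riemannian structure. -/
def variationFrame {κ : Type*} (X : ι → (x : M) → TangentSpace 𝓘(ℝ, E) x)
    (Y : κ → (x : M) → TangentSpace 𝓘(ℝ, E) x) (ε : ℝ) :
    ι ⊕ κ → (x : M) → TangentSpace 𝓘(ℝ, E) x :=
  Sum.elim X (fun j x => ε • Y j x)

/-! ### Horizontal curves, length and distance -/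

/-- The norm `‖v‖_g = (inf {∑ uᵢ² | ∑ uᵢ Xᵢ(x) = v})^{1/2}` that the frame induces on `𝓓_x`
(only meaningful for `v ∈ 𝓓_x`). -/
def frameNorm [Fintype ι] (X : ι → (x : M) → TangentSpace 𝓘(ℝ, E) x) (x : M)
    (v : TangentSpace 𝓘(ℝ, E) x) : ℝ :=
  Real.sqrt (sInf {s : ℝ | ∃ u : ι → ℝ, ∑ i, u i • X i x = v ∧ s = ∑ i, u i ^ 2})

variable (E) in
/-- `γ : [0, T] → M` is absolutely continuous: it is continuous, and absolutely continuous in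
coordinates on every subinterval that it maps into the domain of a chart. -/
def IsACCurve (T : ℝ) (γ : ℝ → M) : Prop :=
  ContinuousOn γ (Icc 0 T) ∧
    ∀ (x₀ : M) (a b : ℝ), 0 ≤ a → a ≤ b → b ≤ T → MapsTo γ (Icc a b) (chartAt E x₀).source →
      AbsolutelyContinuousOnInterval (fun t => chartAt E x₀ (γ t)) a b

/-- `γ : [0, T] → M` is horizontal: it is absolutely continuous and, for some control
`u ∈ L²([0, T], ℝ^N)`, satisfies `γ'(t) = ∑ uᵢ(t) Xᵢ(γ(t))` for almost every `t`. -/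
structure IsHorizontalCurve [Fintype ι] (X : ι → (x : M) → TangentSpace 𝓘(ℝ, E) x)
    (T : ℝ) (γ : ℝ → M) : Prop where
  absolutelyContinuous : IsACCurve E T γ
  exists_control : ∃ u : ℝ → ι → ℝ,
    (∀ i, MemLp (fun t => u t i) 2 (volume.restrict (Icc 0 T))) ∧
    ∀ᵐ t ∂(volume.restrict (Icc 0 T)), HasMFDerivAt 𝓘(ℝ, ℝ) 𝓘(ℝ, E) γ t
      ((1 : ℝ →L[ℝ] ℝ).smulRight (∑ i, u t i • X i (γ t)))

/-- The length `∫₀ᵀ ‖γ'(t)‖_g dt` of a horizontal curve. -/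
def curveLength [Fintype ι] (X : ι → (x : M) → TangentSpace 𝓘(ℝ, E) x)
    (T : ℝ) (γ : ℝ → M) : ℝ≥0∞ :=
  ∫⁻ t in Icc 0 T, ENNReal.ofReal
    (frameNorm X (γ t) (mfderiv 𝓘(ℝ, ℝ) 𝓘(ℝ, E) γ t (1 : ℝ)))

/-- The distance of the structure generated by `X`: the infimum of the lengths of the horizontal
curves between two points. -/
def frameEDist [Fintype ι] (X : ι → (x : M) → TangentSpace 𝓘(ℝ, E) x) (x y : M) : ℝ≥0∞ :=
  ⨅ (T : ℝ) (γ : ℝ → M) (_ : 0 < T) (_ : IsHorizontalCurve X T γ) (_ : γ 0 = x) (_ : γ T = y),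
    curveLength X T γ

/-- The distance from a set `S`, with values in `[0, ∞]`. -/
def edistFrom [Fintype ι] (X : ι → (x : M) → TangentSpace 𝓘(ℝ, E) x) (S : Set M) (x : M) :
    ℝ≥0∞ :=
  ⨅ z ∈ S, frameEDist X z x

/-- The distance from a set `S`, as a real-valued function. -/
def distFrom [Fintype ι] (X : ι → (x : M) → TangentSpace 𝓘(ℝ, E) x) (S : Set M) (x : M) : ℝ :=
  (edistFrom X S x).toReal

/-! ### Domains with smooth boundary and characteristic points -/

variable (E) in
/-- `f` is a local defining function of `Ω` near the boundary point `p`: on an open neighbourhood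
`V` of `p` it is smooth, `Ω ∩ V = {f < 0} ∩ V`, and `df_p ≠ 0`. -/
structure IsLocalDefiningFunction (Ω : Set M) (p : M) (V : Set M) (f : M → ℝ) : Prop where
  isOpen : IsOpen V
  mem : p ∈ V
  smooth : ContMDiffOn 𝓘(ℝ, E) 𝓘(ℝ, ℝ) ∞ f V
  eq_sublevel : Ω ∩ V = {x | f x < 0} ∩ V
  mfderiv_ne_zero : mfderiv 𝓘(ℝ, E) 𝓘(ℝ, ℝ) f p ≠ 0

variable (E) in
/-- The open set `Ω` has smooth boundary. -/
def HasSmoothBoundary (Ω : Set M) : Prop :=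
  ∀ p ∈ frontier Ω, ∃ V f, IsLocalDefiningFunction E Ω p V f

/-- `p ∈ ∂Ω` is a characteristic point: `𝓓_p ⊆ T_p ∂Ω`, where `T_p ∂Ω = ker df_p` for a local
defining function `f` (the kernel does not depend on its choice). -/
def IsCharacteristicPoint (X : ι → (x : M) → TangentSpace 𝓘(ℝ, E) x) (Ω : Set M) (p : M) : Prop :=
  p ∈ frontier Ω ∧ ∃ V f, IsLocalDefiningFunction E Ω p V f ∧
    ∀ v ∈ distribution X p, mfderiv 𝓘(ℝ, E) 𝓘(ℝ, ℝ) f p v = 0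

/-! ### Convergence with all derivatives -/

variable (E) in
/-- `F s → f` along `l`, uniformly on the compact subsets of `U` together with all derivatives:
in every smooth chart `e`, all the iterated derivatives of the coordinate expressions (taken
within the coordinate image of `U`, so one-sided at boundary points of `U`) converge uniformly on
the image of every compact set `K ⊆ U` that lies in the domain of `e`. -/
def TendstoWithAllDerivatives {σ : Type*} (F : σ → M → ℝ) (f : M → ℝ) (l : Filter σ)
    (U : Set M) : Prop :=
  ∀ e ∈ IsManifold.maximalAtlas 𝓘(ℝ, E) ∞ M, ∀ (k : ℕ) (K : Set M),
    IsCompact K → K ⊆ U ∩ e.source →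
      TendstoUniformlyOn
        (fun s y => iteratedFDerivWithin ℝ k (F s ∘ e.symm) (e.target ∩ e.symm ⁻¹' U) y)
        (fun y => iteratedFDerivWithin ℝ k (f ∘ e.symm) (e.target ∩ e.symm ⁻¹' U) y)
        l (e '' K)

end SubRiem

end

/-! Near a noncharacteristic boundary the distance is the solution `φ` of the eikonal equation `∑
(Z_k φ)² = 1` with `φ = 0` on `∂Ω`, where `Z` is the frame `X, εY`. In Hamiltonian form this problem
does not see the drop of rank at `ε = 0`: the Hamiltonian `½ ∑ ξ(Z_k)²` is smooth in `(ε, x, ξ)`,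
and the method of characteristics works as soon as some `X i` is transverse to `∂Ω`, for then the
conormal can be normalised. Hence locally a single function `φ(ε, x)`, smooth in both variables,
describes all the distances at once, and convergence of derivatives becomes continuity of the
`x`-derivatives of `φ` at `ε = 0`.

The characteristics leave `∂Ω` with the unit conormal as covector (`exists_characteristics`). The
inverse function theorem turns flow time into a function of the endpoint, and a Gauss lemma
identifies its differential with the transported covector, which has unit energy
(`exists_local_eikonal`). Smooth dependence of flows on time, data and parameters comes from the
inverse function theorem in a space of continuous paths (`exists_smooth_local_flow`).

That `φ` is the distance needs two inequalities and no minimizers. A characteristic is itself a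
horizontal curve with unit control, so the distance is at most `φ` (`frameEDist_le_of_chart_curve`).
Conversely `φ` is a calibration: by Cauchy–Schwarz it grows along a horizontal curve no faster than
the length, while a curve that leaves the coordinate ball pays a fixed amount, measured by a cutoff
function (`ofReal_le_edistFrom`).

Compactness of `[-εbar, εbar]` makes the neighbourhood uniform in `ε`
(`eventually_hasSmoothDistNear`). -/

noncomputable section

namespace SubRiem

universe u

/-! ### Superposition operators on spaces of continuous maps -/

section Superposition

variable {K : Type*} [TopologicalSpace K] [CompactSpace K]
variable {Z W : Type*} [NormedAddCommGroup Z] [NormedSpace ℝ Z]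
  [NormedAddCommGroup W] [NormedSpace ℝ W]

/-- Pointwise application of a continuous family of operators to a continuous map. -/
def pointwiseApply : C(K, Z →L[ℝ] W) →L[ℝ] C(K, Z) →L[ℝ] C(K, W) :=
  LinearMap.mkContinuous₂ (E := C(K, Z →L[ℝ] W)) (F := C(K, Z)) (G := C(K, W))
    (LinearMap.mk₂ ℝ (fun A x => ⟨fun t => A t (x t), A.continuous.clm_apply x.continuous⟩)
      (fun A B x => by ext t; simp) (fun c A x => by ext t; simp)
      (fun A x y => by ext t; simp) (fun c A x => by ext t; simp))
    1 (fun A x => by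
      rw [ContinuousMap.norm_le _ (by positivity)]
      intro t
      rw [one_mul]
      exact (A t).le_of_opNorm_le_of_le (A.norm_coe_le_norm t) (x.norm_coe_le_norm t))

@[simp] lemma pointwiseApply_apply (A : C(K, Z →L[ℝ] W)) (x : C(K, Z)) (t : K) :
    pointwiseApply A x t = A t (x t) := rfl

/-- The mean value inequality is applied at each `t`; what matters is that `g'` varies little near
`x t` uniformly in `t ∈ K`. -/
lemma hasFDerivAt_postcomp {g : Z → W} {g' : Z → Z →L[ℝ] W} (hg : Continuous g)
    (hg' : Continuous g') (h : ∀ z, HasFDerivAt g (g' z) z) (x : C(K, Z)) :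
    HasFDerivAt (fun y : C(K, Z) => (ContinuousMap.mk g hg).comp y)
      (pointwiseApply ((ContinuousMap.mk g' hg').comp x)) x := by
  rw [hasFDerivAt_iff_isLittleO, Asymptotics.isLittleO_iff]
  intro c hc
  -- Translating `x` by constants `v` and using continuity of postcomposition in the sup norm yields
  -- one radius `δ` for all `t`, without local compactness of `Z`.
  have hcont : ContinuousAt
      (fun v : Z => (ContinuousMap.mk g' hg').comp (x + ContinuousMap.const K v)) 0 := by
    have h1 : Continuous fun v : Z => x + ContinuousMap.const K v :=
      continuous_const.add ContinuousMap.continuous_const'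
    exact ((ContinuousMap.continuous_postcomp _).comp h1).continuousAt
  obtain ⟨δ, hδ, hball⟩ := Metric.mem_nhds_iff.1 
    (hcont (Metric.ball_mem_nhds (α := C(K, Z →L[ℝ] W)) _ hc))
  have hder : ∀ (t : K) (z : Z), z ∈ Metric.ball (x t) δ → ‖g' z - g' (x t)‖ ≤ c := by
    intro t z hz
    have h1 := hball (show z - x t ∈ Metric.ball 0 δ by simpa [dist_eq_norm] using hz)
    have h2 := (ContinuousMap.dist_apply_le_dist (f := (ContinuousMap.mk g' hg').comp
      (x + ContinuousMap.const K (z - x t))) (g := (ContinuousMap.mk g' hg').comp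
      (x + ContinuousMap.const K 0)) t).trans (Metric.mem_ball.1 h1).le
    simpa [dist_eq_norm] using h2
  filter_upwards [Metric.ball_mem_nhds x hδ] with y hy
  rw [ContinuousMap.norm_le _ (by positivity)]
  intro t
  have hyt : y t ∈ Metric.ball (x t) δ :=
    lt_of_le_of_lt (ContinuousMap.dist_apply_le_dist (f := y) (g := x) t) hy
  have := (convex_ball (x t) δ).norm_image_sub_le_of_norm_hasFDerivWithin_le' (𝕜 := ℝ)
    (fun z _ => (h z).hasFDerivWithinAt) (hder t) (Metric.mem_ball_self hδ) hyt
  calc _ = ‖g (y t) - g (x t) - g' (x t) (y t - x t)‖ := by simp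
    _ ≤ c * ‖y t - x t‖ := this
    _ ≤ c * ‖y - x‖ := by
        gcongr
        exact (y - x).norm_coe_le_norm t

lemma contDiff_pointwiseApply {n : WithTop ℕ∞} :
    ContDiff ℝ n (fun A : C(K, Z →L[ℝ] W) => pointwiseApply A) :=
  ContinuousLinearMap.contDiff (𝕜 := ℝ) (E := C(K, Z →L[ℝ] W)) (F := C(K, Z) →L[ℝ] C(K, W)) _

end Superposition

/-- Induction on `n`: the derivative is postcomposition with `g'` followed by the bounded linear map
`pointwiseApply`. The target `W` is generalised because it becomes `Z →L[ℝ] W`; the common universe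
keeps that inside the induction. -/
lemma contDiff_postcomp {K : Type*} [TopologicalSpace K] [CompactSpace K]
    {Z : Type u} [NormedAddCommGroup Z] [NormedSpace ℝ Z] (n : ℕ) :
    ∀ {W : Type u} [NormedAddCommGroup W] [NormedSpace ℝ W] (g : Z → W) (hg : ContDiff ℝ n g),
      ContDiff ℝ n (fun y : C(K, Z) => (ContinuousMap.mk g hg.continuous).comp y) := by
  induction n with
  | zero =>
    intro W _ _ g hg
    exact contDiff_zero.2 (ContinuousMap.continuous_postcomp _)
  | succ n ih =>
    intro W _ _ g hg
    have hg0 : ContDiff ℝ (n + 1) g := by exact_mod_cast hg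
    obtain ⟨g', hg', hd⟩ := contDiff_succ_iff_hasFDerivAt.1 hg0
    have : ContDiff ℝ (n + 1) (fun y : C(K, Z) => (ContinuousMap.mk g hg.continuous).comp y) :=
      contDiff_succ_iff_hasFDerivAt.2
        ⟨fun x => pointwiseApply ((ContinuousMap.mk g' hg'.continuous).comp x),
          contDiff_pointwiseApply.comp (ih g' hg'),
          fun x => hasFDerivAt_postcomp hg.continuous hg'.continuous hd x⟩
    exact_mod_cast this

lemma contDiff_infty_postcomp {K : Type*} [TopologicalSpace K] [CompactSpace K]
    {Z W : Type u} [NormedAddCommGroup Z] [NormedSpace ℝ Z] [NormedAddCommGroup W]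
    [NormedSpace ℝ W] {g : Z → W} (hg : ContDiff ℝ ∞ g) :
    ContDiff ℝ ∞ (fun y : C(K, Z) => (ContinuousMap.mk g hg.continuous).comp y) :=
  contDiff_infty.2 fun n => contDiff_postcomp n g (contDiff_infty.1 hg n)

/-! ### Primitives -/

section Primitive

variable {Z : Type*} [NormedAddCommGroup Z]

/-- The interval `[-1, 1]`. -/
abbrev unitIcc : Set ℝ := Icc (-1 : ℝ) 1

/-- Extension of a continuous map on `[-1, 1]` to the real line by constants. -/
def extendIcc (x : C(unitIcc, Z)) (t : ℝ) : Z := x (projIcc (-1 : ℝ) 1 (by norm_num) t)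

lemma continuous_extendIcc (x : C(unitIcc, Z)) : Continuous (extendIcc x) :=
  x.continuous.comp continuous_projIcc

lemma extendIcc_of_mem (x : C(unitIcc, Z)) {t : ℝ} (ht : t ∈ unitIcc) :
    extendIcc x t = x ⟨t, ht⟩ := by
  rw [extendIcc, projIcc_of_mem _ ht]

variable [NormedSpace ℝ Z]

/-- The primitive vanishing at `0`, on `[-1, 1]`. -/
def primitive : C(unitIcc, Z) →L[ℝ] C(unitIcc, Z) :=
  LinearMap.mkContinuous
    { toFun := fun x => ⟨fun t => ∫ s in (0 : ℝ)..t, extendIcc x s,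
        (intervalIntegral.continuous_primitive
          (fun a b => (continuous_extendIcc x).intervalIntegrable a b) 0).comp
            continuous_subtype_val⟩
      map_add' := fun x y => by
        ext t
        exact intervalIntegral.integral_add ((continuous_extendIcc x).intervalIntegrable _ _)
          ((continuous_extendIcc y).intervalIntegrable _ _)
      map_smul' := fun c x => by
        ext t
        exact intervalIntegral.integral_smul c _ }
    1 (fun x => by
      rw [ContinuousMap.norm_le _ (by positivity)]
      intro t
      have h := intervalIntegral.norm_integral_le_of_norm_le_const (a := 0) (b := (t : ℝ))
        (C := ‖x‖) (f := extendIcc x) (fun s _ => x.norm_coe_le_norm _)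
      have ht : |(t : ℝ)| ≤ 1 := abs_le.2 t.2
      calc _ ≤ ‖x‖ * |(t : ℝ) - 0| := h
        _ ≤ 1 * ‖x‖ := by rw [sub_zero, mul_comm]; gcongr)

end Primitive

/-! ### The inverse function theorem on open sets -/

/-- Smoothness of the inverse on its whole domain requires an invertible derivative at every point
of the source, so the source is cut down to the open set where `fderiv ℝ F` is invertible. -/
lemma exists_smooth_localInverse {Z W : Type*} [NormedAddCommGroup Z] [NormedSpace ℝ Z]
    [CompleteSpace Z] [NormedAddCommGroup W] [NormedSpace ℝ W] [CompleteSpace W]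
    {F : Z → W} {O : Set Z} (hO : IsOpen O) (hF : ContDiffOn ℝ ∞ F O) {a : Z} (ha : a ∈ O)
    (F' : Z ≃L[ℝ] W) (hF' : HasFDerivAt F (F' : Z →L[ℝ] W) a) :
    ∃ e : OpenPartialHomeomorph Z W, (∀ z, e z = F z) ∧ a ∈ e.source ∧ e.source ⊆ O ∧
      ContDiffOn ℝ ∞ e.symm e.target := by
  have hat : ∀ z ∈ O, ContDiffAt ℝ ∞ F z := fun z hz => hF.contDiffAt (hO.mem_nhds hz)
  have hcont : ContinuousOn (fderiv ℝ F) O := hF.continuousOn_fderiv_of_isOpen hO (by simp)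
  set e₀ := (hat a ha).toOpenPartialHomeomorph F hF' (by simp)
  set R : Set (Z →L[ℝ] W) := range ContinuousLinearEquiv.toContinuousLinearMap
  have hR : IsOpen R := ContinuousLinearEquiv.isOpen
  have hO' : IsOpen (O ∩ fderiv ℝ F ⁻¹' R) := hcont.isOpen_inter_preimage hO hR
  refine ⟨e₀.restrOpen _ hO', fun z => rfl, ?_, fun z hz => hz.2.1, ?_⟩
  · exact ⟨(hat a ha).mem_toOpenPartialHomeomorph_source hF' (by simp), ha, F', hF'.fderiv.symm⟩
  · intro w hw
    have hz : (e₀.restrOpen _ hO').symm w ∈ (e₀.restrOpen _ hO').source :=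
      (e₀.restrOpen _ hO').map_target hw
    obtain ⟨hzO, G', hG'⟩ := hz.2
    refine (OpenPartialHomeomorph.contDiffAt_symm (f₀' := G') _ hw ?_ (hat _ hzO)).contDiffWithinAt
    have := ((hat _ hzO).differentiableAt (by simp)).hasFDerivAt
    rwa [← hG'] at this

/-! ### Smooth local flows -/

section Flow

variable {Z : Type u} [NormedAddCommGroup Z] [NormedSpace ℝ Z]

/-- The inclusion of constant maps. -/
def constCLM : Z →L[ℝ] C(unitIcc, Z) :=
  LinearMap.mkContinuous
    { toFun := fun w => ContinuousMap.const unitIcc w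
      map_add' := fun x y => by ext t; simp
      map_smul' := fun c x => by ext t; simp }
    1 (fun w => by
      rw [ContinuousMap.norm_le _ (by positivity)]
      intro t
      simp)

@[simp] lemma constCLM_apply (w : Z) (t : unitIcc) : constCLM w t = w := rfl

/-- The map whose zero set in the last variable consists of the solutions of `x' = l • g x`,
`x 0 = w` on `[-1, 1]`. -/
def picardDefect {g : Z → Z} (hg : Continuous g) (q : ℝ × Z × C(unitIcc, Z)) :
    ℝ × Z × C(unitIcc, Z) :=
  (q.1, q.2.1, q.2.2 - constCLM q.2.1 - q.1 • primitive ((ContinuousMap.mk g hg).comp q.2.2))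

lemma contDiff_picardDefect {g : Z → Z} (hg : ContDiff ℝ ∞ g) :
    ContDiff ℝ ∞ (picardDefect hg.continuous) := by
  have h1 : ContDiff ℝ ∞ (fun q : ℝ × Z × C(unitIcc, Z) =>
      (ContinuousMap.mk g hg.continuous).comp q.2.2) :=
    (contDiff_infty_postcomp hg).comp contDiff_snd.snd
  have h2 : ContDiff ℝ ∞ (fun x : C(unitIcc, Z) => primitive x) :=
    ContinuousLinearMap.contDiff (𝕜 := ℝ) (E := C(unitIcc, Z)) (F := C(unitIcc, Z)) _
  have h3 : ContDiff ℝ ∞ (fun x : Z => constCLM x) :=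
    ContinuousLinearMap.contDiff (𝕜 := ℝ) (E := Z) (F := C(unitIcc, Z)) _
  exact contDiff_fst.prodMk (contDiff_snd.fst.prodMk
    ((contDiff_snd.snd.sub (h3.comp contDiff_snd.fst)).sub (contDiff_fst.smul (h2.comp h1))))

/-- The derivative of `picardDefect` at `l = 0`. -/
def picardShear (v : C(unitIcc, Z)) : (ℝ × Z × C(unitIcc, Z)) ≃L[ℝ] (ℝ × Z × C(unitIcc, Z)) where
  toFun q := (q.1, q.2.1, q.2.2 - constCLM q.2.1 - q.1 • v)
  invFun q := (q.1, q.2.1, q.2.2 + constCLM q.2.1 + q.1 • v)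
  map_add' p q := by
    refine Prod.ext rfl (Prod.ext rfl ?_)
    simp only [Prod.fst_add, Prod.snd_add, map_add, add_smul]
    abel
  map_smul' c q := by
    refine Prod.ext rfl (Prod.ext rfl ?_)
    simp only [Prod.smul_fst, Prod.smul_snd, map_smul, smul_eq_mul, mul_smul, RingHom.id_apply,
      smul_sub]
  left_inv q := by
    refine Prod.ext rfl (Prod.ext rfl ?_)
    simp only
    abel
  right_inv q := by
    refine Prod.ext rfl (Prod.ext rfl ?_)
    simp only
    abel
  continuous_toFun := by
    have := (constCLM (Z := Z)).continuous
    fun_prop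
  continuous_invFun := by
    have := (constCLM (Z := Z)).continuous
    fun_prop

/-- At `l = 0` the factor `l` kills the derivative of the nonlinear term, so only its value
survives, in the `l` direction, and the derivative is triangular. -/
lemma hasFDerivAt_picardDefect {g : Z → Z} (hg : ContDiff ℝ ∞ g) (w : Z) (x : C(unitIcc, Z)) :
    HasFDerivAt (picardDefect hg.continuous)
      (picardShear (primitive ((ContinuousMap.mk g hg.continuous).comp x)) :
        (ℝ × Z × C(unitIcc, Z)) →L[ℝ] (ℝ × Z × C(unitIcc, Z))) (0, w, x) := by
  have h1 : ContDiff ℝ ∞ (fun q : ℝ × Z × C(unitIcc, Z) =>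
      (ContinuousMap.mk g hg.continuous).comp q.2.2) :=
    (contDiff_infty_postcomp hg).comp contDiff_snd.snd
  have h2 : ContDiff ℝ ∞ (fun x : C(unitIcc, Z) => primitive x) :=
    ContinuousLinearMap.contDiff (𝕜 := ℝ) (E := C(unitIcc, Z)) (F := C(unitIcc, Z)) _
  have h3 : ContDiff ℝ ∞ (fun x : Z => constCLM x) :=
    ContinuousLinearMap.contDiff (𝕜 := ℝ) (E := Z) (F := C(unitIcc, Z)) _
  have hP := (((h2.comp h1).differentiable (by simp)) (0, w, x)).hasFDerivAt
  have hs := (hasFDerivAt_fst (𝕜 := ℝ) (p := ((0 : ℝ), w, x))).smul hP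
  have hc : HasFDerivAt (fun q : ℝ × Z × C(unitIcc, Z) => constCLM q.2.1)
      (constCLM.comp ((ContinuousLinearMap.fst ℝ Z C(unitIcc, Z)).comp
        (ContinuousLinearMap.snd ℝ ℝ (Z × C(unitIcc, Z))))) (0, w, x) :=
    ContinuousLinearMap.hasFDerivAt (𝕜 := ℝ) (E := ℝ × Z × C(unitIcc, Z))
      (F := C(unitIcc, Z)) (constCLM.comp ((ContinuousLinearMap.fst ℝ Z C(unitIcc, Z)).comp
        (ContinuousLinearMap.snd ℝ ℝ (Z × C(unitIcc, Z)))))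
  have hall := (hasFDerivAt_fst (𝕜 := ℝ) (p := ((0 : ℝ), w, x))).prodMk
    ((hasFDerivAt_snd (𝕜 := ℝ) (p := ((0 : ℝ), w, x))).fst.prodMk
      (((hasFDerivAt_snd (𝕜 := ℝ) (p := ((0 : ℝ), w, x))).snd.sub hc).sub hs))
  refine hall.congr_fderiv ?_
  ext q <;> simp [picardShear]

lemma picardDefect_eq_iff {g : Z → Z} (hg : Continuous g) (l : ℝ) (w : Z) (x : C(unitIcc, Z)) :
    picardDefect hg (l, w, x) = (l, w, 0) ↔
      ∀ t : unitIcc, x t = w + l • ∫ s in (0 : ℝ)..t, g (extendIcc x s) := by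
  have : picardDefect hg (l, w, x) = (l, w, 0) ↔
      x - constCLM w - l • primitive ((ContinuousMap.mk g hg).comp x) = 0 := by
    simp [picardDefect]
  rw [this, ContinuousMap.ext_iff]
  refine forall_congr' fun t => ?_
  rw [← sub_eq_zero (a := x t), ← sub_sub]
  rfl

/-- Time is made a parameter: `x' = l • g x` is solved on the fixed interval `[-1, 1]` for small `l`
by inverting `picardDefect`, and the flow at time `l` is the value of the solution at `1`.
Smoothness in time and initial point is then that of the inverse map; the differential equation in
`l` is recovered from a scaling identity. -/
theorem exists_smooth_local_flow [CompleteSpace Z] {g : Z → Z} (hg : ContDiff ℝ ∞ g) (z₀ : Z) :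
    ∃ r > 0, ∃ Φ : ℝ × Z → Z, ContDiffOn ℝ ∞ Φ (Metric.ball (0, z₀) r) ∧
      ∀ z ∈ Metric.ball z₀ r, Φ (0, z) = z ∧
        ∀ t, |t| < r → HasDerivAt (fun s => Φ (s, z)) (g (Φ (t, z))) t := by
  obtain ⟨e, he, hmem, -, hsymm⟩ := exists_smooth_localInverse isOpen_univ
    (contDiff_picardDefect hg).contDiffOn (mem_univ (0, z₀, constCLM z₀)) _
    (hasFDerivAt_picardDefect hg z₀ (constCLM z₀))
  set c₀ : C(unitIcc, Z) := constCLM z₀ with hc₀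
  set sol : ℝ × Z → C(unitIcc, Z) := fun p => (e.symm (p.1, p.2, 0)).2.2 with hsol
  set T : Set (ℝ × Z) := {p | (p.1, p.2, (0 : C(unitIcc, Z))) ∈ e.target} with hT
  have hTo : IsOpen T := e.open_target.preimage (by fun_prop)
  have hbase : e (0, z₀, c₀) = (0, z₀, 0) := by
    rw [he]
    exact (picardDefect_eq_iff _ _ _ _).2 fun t => by simp [hc₀]
  have hbaseT : ((0 : ℝ), z₀) ∈ T := by
    have := e.map_source hmem
    rwa [hbase] at this
  have hsolT : ∀ p ∈ T, e.symm (p.1, p.2, 0) = (p.1, p.2, sol p) := by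
    intro p hp
    have h1 := e.right_inv hp
    rw [he] at h1
    have h2 := congrArg Prod.fst h1
    have h3 := congrArg (fun q => q.2.1) h1
    exact Prod.ext h2 (Prod.ext h3 rfl)
  have hsolsmooth : ContDiffOn ℝ ∞ sol T := by
    have : ContDiffOn ℝ ∞ (fun p : ℝ × Z => e.symm (p.1, p.2, (0 : C(unitIcc, Z)))) T :=
      hsymm.comp (contDiff_fst.prodMk (contDiff_snd.prodMk contDiff_const)).contDiffOn
        fun p hp => hp
    exact this.snd.snd
  have hsoleq : ∀ p ∈ T, ∀ t : unitIcc,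
      sol p t = p.2 + p.1 • ∫ s in (0 : ℝ)..t, g (extendIcc (sol p) s) := by
    intro p hp
    rw [← picardDefect_eq_iff hg.continuous, ← hsolT p hp, ← he]
    exact e.right_inv hp
  -- Injectivity of `e` on its source is uniqueness of solutions close to the constant path.
  have huniq : ∀ l w x, (l, w, x) ∈ e.source →
      (∀ t : unitIcc, x t = w + l • ∫ s in (0 : ℝ)..t, g (extendIcc x s)) → sol (l, w) = x := by
    intro l w x hx hfix
    have h1 := e.left_inv hx
    rw [he, (picardDefect_eq_iff hg.continuous _ _ _).2 hfix] at h1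
    rw [hsol]
    simp only [h1]
  have hsol0 : sol (0, z₀) = c₀ := huniq 0 z₀ c₀ hmem fun t => by simp [hc₀]
  obtain ⟨ρ, hρ, hρsub⟩ := Metric.isOpen_iff.1 e.open_source _ hmem
  have hnear : {p | p ∈ T ∧ dist (sol p) c₀ < ρ} ∈ 𝓝 ((0 : ℝ), z₀) := by
    refine inter_mem (hTo.mem_nhds hbaseT) ?_
    have := (hsolsmooth.continuousOn.continuousAt (hTo.mem_nhds hbaseT))
    have h2 := this (Metric.ball_mem_nhds (α := C(unitIcc, Z)) _ hρ)
    rw [hsol0] at h2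
    exact h2
  obtain ⟨r₁, hr₁, hr₁sub⟩ := Metric.mem_nhds_iff.1 hnear
  set r₀ := min r₁ ρ with hr₀
  have hr₀pos : 0 < r₀ := lt_min hr₁ hρ
  have hball : ∀ l w, |l| < r₀ → dist w z₀ < r₀ → (l, w) ∈ T ∧ dist (sol (l, w)) c₀ < ρ := by
    intro l w hl hw
    refine hr₁sub ?_
    rw [Metric.mem_ball, Prod.dist_eq]
    exact max_lt (by simpa using hl.trans_le (min_le_left _ _)) (hw.trans_le (min_le_left _ _))
  -- The path `t ↦ sol (l, w) (σ t)` solves the equation with speed `σ l` and stays within `ρ` of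
  -- `c₀`, so uniqueness applies to it.
  have hscale : ∀ l w, |l| < r₀ → dist w z₀ < r₀ → ∀ σ : unitIcc,
      sol (σ * l, w) ⟨1, by simp⟩ = sol (l, w) σ := by
    intro l w hl hw σ
    obtain ⟨hlT, hdist⟩ := hball l w hl hw
    have hσ : |(σ : ℝ)| ≤ 1 := abs_le.2 σ.2
    have hmul : ∀ t : unitIcc, (σ : ℝ) * t ∈ unitIcc := fun t => by
      have ht : |(t : ℝ)| ≤ 1 := abs_le.2 t.2
      refine abs_le.1 ?_
      rw [abs_mul]
      exact mul_le_one₀ hσ (abs_nonneg _) ht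
    let x' : C(unitIcc, Z) := ⟨fun t => sol (l, w) ⟨σ * t, hmul t⟩, by fun_prop⟩
    have hx'src : (σ * l, w, x') ∈ e.source := by
      refine hρsub ?_
      rw [Metric.mem_ball, Prod.dist_eq, Prod.dist_eq]
      refine max_lt ?_ (max_lt (hw.trans_le (min_le_right _ _)) ?_)
      · have : |σ * l| < ρ := by
          rw [abs_mul]
          calc |(σ : ℝ)| * |l| ≤ 1 * |l| := by gcongr
            _ < ρ := by rw [one_mul]; exact hl.trans_le (min_le_right _ _)
        simpa using this
      · rw [ContinuousMap.dist_lt_iff hρ]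
        intro t
        exact (ContinuousMap.dist_apply_le_dist (f := sol (l, w)) (g := c₀) ⟨σ * t, hmul t⟩).trans_lt
          hdist
    have hfix : ∀ t : unitIcc,
        x' t = w + (σ * l) • ∫ s in (0 : ℝ)..t, g (extendIcc x' s) := by
      intro t
      have h1 := hsoleq _ hlT ⟨σ * t, hmul t⟩
      have h2 := intervalIntegral.smul_integral_comp_mul_left
        (fun s => g (extendIcc (sol (l, w)) s)) (σ : ℝ) (a := 0) (b := t)
      have h3 : ∫ s in (0 : ℝ)..t, g (extendIcc x' s) =
          ∫ s in (0 : ℝ)..t, g (extendIcc (sol (l, w)) (σ * s)) := by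
        refine intervalIntegral.integral_congr fun s hs => ?_
        have hs' : s ∈ unitIcc := by
          refine (uIcc_subset_Icc (by norm_num : (0 : ℝ) ∈ Icc (-1 : ℝ) 1) t.2) hs
        have hs2 : (σ : ℝ) * s ∈ unitIcc := hmul ⟨s, hs'⟩
        simp only [extendIcc_of_mem _ hs', extendIcc_of_mem _ hs2]
        rfl
      rw [mul_zero] at h2
      rw [h3, mul_comm, mul_smul, h2]
      exact h1
    rw [huniq _ _ _ hx'src hfix]
    exact congrArg (sol (l, w)) (Subtype.ext (mul_one _))
  refine ⟨r₀ / 2, by positivity, fun p => sol p ⟨1, by simp⟩, ?_, ?_⟩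
  · have hev : ContDiff ℝ ∞ (fun x : C(unitIcc, Z) => x ⟨1, by simp⟩) :=
      ContinuousLinearMap.contDiff (𝕜 := ℝ) (E := C(unitIcc, Z)) (F := Z)
        (ContinuousMap.evalCLM ℝ ⟨1, by simp⟩)
    refine hev.comp_contDiffOn (hsolsmooth.mono ?_)
    rintro ⟨l, w⟩ hlw
    rw [Metric.mem_ball, Prod.dist_eq, max_lt_iff] at hlw
    refine (hball l w ?_ ?_).1
    · have := hlw.1
      simp only [dist_zero_right, Real.norm_eq_abs] at this
      linarith
    · have := hlw.2
      simp only at this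
      linarith
  · intro z hz
    rw [Metric.mem_ball] at hz
    have hz' : dist z z₀ < r₀ := by linarith
    have h0 : |(0 : ℝ)| < r₀ := by simpa using hr₀pos
    refine ⟨?_, ?_⟩
    · have := hsoleq _ (hball 0 z h0 hz').1 ⟨1, by simp⟩
      simpa using this
    · intro t ht
      -- One reference solution, of speed `l`, contains the flow at all times `|s| < l`; its
      -- integral equation can then be differentiated in `s`.
      set l := r₀ / 2 with hl
      have hlpos : 0 < l := by positivity
      have hlabs : |l| < r₀ := by rw [abs_of_pos hlpos]; linarith
      set x := sol (l, z) with hx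
      have hmem : ∀ s, |s| < l → s / l ∈ Ioo (-1 : ℝ) 1 := fun s hs => by
        rw [mem_Ioo, ← abs_lt, abs_div, abs_of_pos hlpos, div_lt_one hlpos]
        exact hs
      have key : ∀ s (hs : |s| < l),
          sol (s, z) ⟨1, by simp⟩ = x ⟨s / l, Ioo_subset_Icc_self (hmem s hs)⟩ := by
        intro s hs
        have := hscale l z hlabs hz' ⟨s / l, Ioo_subset_Icc_self (hmem s hs)⟩
        simpa [div_mul_cancel₀ _ hlpos.ne'] using this
      have key2 : ∀ s, |s| < l → sol (s, z) ⟨1, by simp⟩ =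
          z + l • ∫ s in (0 : ℝ)..(s / l), g (extendIcc x s) := by
        intro s hs
        rw [key s hs]
        exact hsoleq _ (hball l z hlabs hz').1 _
      have hgc : Continuous fun s => g (extendIcc x s) :=
        hg.continuous.comp (continuous_extendIcc x)
      have hI : HasDerivAt (fun σ => ∫ s in (0 : ℝ)..σ, g (extendIcc x s))
          (g (extendIcc x (t / l))) (t / l) :=
        intervalIntegral.integral_hasDerivAt_right (hgc.intervalIntegrable _ _)
          (hgc.stronglyMeasurableAtFilter _ _) hgc.continuousAt
      have hd : HasDerivAt (fun s : ℝ => s / l) (1 / l) t := (hasDerivAt_id t).div_const l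
      have hcomp := ((hI.scomp t hd).const_smul l).const_add z
      rw [smul_smul, mul_one_div_cancel hlpos.ne', one_smul,
        extendIcc_of_mem x (Ioo_subset_Icc_self (hmem t ht)), ← key t ht] at hcomp
      refine hcomp.congr_of_eventuallyEq ?_
      have : {s : ℝ | |s| < l} ∈ 𝓝 t := (isOpen_lt continuous_abs continuous_const).mem_nhds ht
      filter_upwards [this] with s hs
      exact key2 s hs

/-- Smooth local flows of vector fields that depend on a parameter. -/
theorem exists_smooth_local_flow_param {P : Type*} [NormedAddCommGroup P] [NormedSpace ℝ P]
    [CompleteSpace P] [CompleteSpace Z] {g : P × Z → Z} (hg : ContDiff ℝ ∞ g) (a₀ : P) (z₀ : Z) :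
    ∃ r > 0, ∃ Φ : ℝ × P × Z → Z, ContDiffOn ℝ ∞ Φ (Metric.ball (0, a₀, z₀) r) ∧
      ∀ a ∈ Metric.ball a₀ r, ∀ z ∈ Metric.ball z₀ r, Φ (0, a, z) = z ∧
        ∀ t, |t| < r → HasDerivAt (fun s => Φ (s, a, z)) (g (a, Φ (t, a, z))) t := by
  obtain ⟨r, hr, Φ, hΦ, h⟩ := exists_smooth_local_flow (g := fun q : P × Z => ((0 : P), g q))
    (contDiff_const.prodMk hg) (a₀, z₀)
  refine ⟨r, hr, fun q => (Φ q).2, hΦ.snd, ?_⟩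
  intro a ha z hz
  have haz : (a, z) ∈ Metric.ball (a₀, z₀) r := by
    rw [← ball_prod_same]
    exact ⟨ha, hz⟩
  obtain ⟨h0, hd⟩ := h (a, z) haz
  -- The parameter was adjoined as a state variable with zero velocity, so it stays constant.
  have hfst : ∀ t, |t| < r → (Φ (t, a, z)).1 = a := by
    intro t ht
    have hconst := (convex_ball (0 : ℝ) r).is_const_of_fderivWithin_eq_zero (𝕜 := ℝ)
      (f := fun s => (Φ (s, a, z)).1)
      (fun s hs => (hasFDerivAt_fst.comp_hasDerivAt s (hd s (by simpa using hs))).differentiableAt.differentiableWithinAt)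
      (fun s hs => by
        have h1 := (hasFDerivAt_fst.comp_hasDerivAt s (hd s (by simpa using hs))).hasFDerivAt.hasFDerivWithinAt
          (s := Metric.ball (0 : ℝ) r)
        refine (h1.fderivWithin (Metric.isOpen_ball.uniqueDiffWithinAt hs)).trans ?_
        ext
        simp)
      (show t ∈ Metric.ball (0 : ℝ) r by simpa using ht) (Metric.mem_ball_self hr)
    rw [hconst, h0]
  refine ⟨congrArg Prod.snd h0, fun t ht => ?_⟩
  have := hasFDerivAt_snd.comp_hasDerivAt t (hd t ht)
  rwa [show Φ (t, a, z) = (a, (Φ (t, a, z)).2) from Prod.ext (hfst t ht) rfl] at this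

end Flow

/-! ### Conservation laws of the Hamiltonian flow -/

section Conservation

variable {E : Type*} [NormedAddCommGroup E] [NormedSpace ℝ E] {κ : Type*} [Fintype κ]

/-- With `u k = ξ (V k)`, the derivative of `∑ (u k)²` is a double sum of `u k * u l` against an
expression antisymmetric in `k, l`. -/
lemma hasDerivAt_energy {V : κ → E → E} (hV : ∀ k, Differentiable ℝ (V k)) {x : ℝ → E}
    {ξ : ℝ → E →L[ℝ] ℝ} {t : ℝ}
    (hx : HasDerivAt x (∑ k, ξ t (V k (x t)) • V k (x t)) t)
    (hξ : HasDerivAt ξ (-∑ k, ξ t (V k (x t)) • (ξ t).comp (fderiv ℝ (V k) (x t))) t) :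
    HasDerivAt (fun s => ∑ k, ξ s (V k (x s)) ^ 2) 0 t := by
  have hu : ∀ k, HasDerivAt (fun s => ξ s (V k (x s)))
      (-∑ l, ξ t (V l (x t)) * ξ t (fderiv ℝ (V l) (x t) (V k (x t))) +
        ∑ l, ξ t (V l (x t)) * ξ t (fderiv ℝ (V k) (x t) (V l (x t)))) t := by
    intro k
    have h1 := (hV k (x t)).hasFDerivAt.comp_hasDerivAt t hx
    convert! hξ.clm_apply h1 using 1
    simp [map_sum]
  have hsq : ∀ k ∈ Finset.univ, HasDerivAt (fun s => ξ s (V k (x s)) ^ 2) _ t :=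
    fun k _ => (hu k).pow 2
  convert! HasDerivAt.fun_sum hsq using 1
  have hswap : ∑ k, ∑ l, ξ t (V k (x t)) * (ξ t (V l (x t)) *
      ξ t (fderiv ℝ (V l) (x t) (V k (x t)))) = ∑ k, ∑ l, ξ t (V k (x t)) * (ξ t (V l (x t)) *
      ξ t (fderiv ℝ (V k) (x t) (V l (x t)))) := by
    rw [Finset.sum_comm]
    refine Finset.sum_congr rfl fun k _ => Finset.sum_congr rfl fun l _ => by ring
  have : ∀ k, (2 : ℕ) * ξ t (V k (x t)) ^ (2 - 1) *
      (-∑ l, ξ t (V l (x t)) * ξ t (fderiv ℝ (V l) (x t) (V k (x t))) +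
        ∑ l, ξ t (V l (x t)) * ξ t (fderiv ℝ (V k) (x t) (V l (x t)))) =
      2 * (∑ l, ξ t (V k (x t)) * (ξ t (V l (x t)) *
      ξ t (fderiv ℝ (V k) (x t) (V l (x t)))) - ∑ l, ξ t (V k (x t)) * (ξ t (V l (x t)) *
      ξ t (fderiv ℝ (V l) (x t) (V k (x t))))) := by
    intro k
    rw [← Finset.mul_sum, ← Finset.mul_sum]
    push_cast
    ring
  simp_rw [this]
  rw [← Finset.mul_sum, Finset.sum_sub_distrib, hswap, sub_self, mul_zero]

/-- The core of the Gauss lemma. Differentiating `ξ (∂ₛ x)` in time, the terms containing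
derivatives of the fields cancel, and `∑ u k * ∂ₛ (u k)` remains. This is half the `s`-derivative of
the energy, which is constantly `1` on the whole family. -/
lemma hasDerivAt_momentum {V : κ → E → E} (hV : ∀ k, Differentiable ℝ (V k)) {O : Set (ℝ × ℝ)}
    (hO : IsOpen O) {x : ℝ × ℝ → E} {ξ : ℝ × ℝ → E →L[ℝ] ℝ} (hxs : ContDiffOn ℝ ∞ x O)
    (hξs : ContDiffOn ℝ ∞ ξ O)
    (hx : ∀ q ∈ O, HasDerivAt (fun t => x (t, q.2)) (∑ k, ξ q (V k (x q)) • V k (x q)) q.1)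
    (hξ : ∀ q ∈ O, HasDerivAt (fun t => ξ (t, q.2))
      (-∑ k, ξ q (V k (x q)) • (ξ q).comp (fderiv ℝ (V k) (x q))) q.1)
    (hE : ∀ q ∈ O, ∑ k, ξ q (V k (x q)) ^ 2 = 1) {q : ℝ × ℝ} (hq : q ∈ O) :
    HasDerivAt (fun t => ξ (t, q.2) (fderiv ℝ x (t, q.2) (0, 1))) 0 q.1 := by
  obtain ⟨t, s⟩ := q
  have hxat : ∀ q ∈ O, ContDiffAt ℝ ∞ x q := fun q hq => hxs.contDiffAt (hO.mem_nhds hq)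
  have hline₁ : HasDerivAt (fun τ : ℝ => (τ, s)) ((1 : ℝ), (0 : ℝ)) t :=
    (hasDerivAt_id t).prodMk (hasDerivAt_const t s)
  have hline₂ : ∀ σ : ℝ, HasDerivAt (fun σ : ℝ => (t, σ)) ((0 : ℝ), (1 : ℝ)) σ := fun σ =>
    (hasDerivAt_const σ t).prodMk (hasDerivAt_id σ)
  have hD : HasFDerivAt (fderiv ℝ x) (fderiv ℝ (fderiv ℝ x) (t, s)) (t, s) :=
    (((hxat _ hq).fderiv_right (m := ∞) (by simp)).differentiableAt (by simp)).hasFDerivAt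
  have hη : HasDerivAt (fun τ => fderiv ℝ x (τ, s) (0, 1))
      (fderiv ℝ (fderiv ℝ x) (t, s) (1, 0) (0, 1)) t := by
    have h1 : HasDerivAt (fun τ => fderiv ℝ x (τ, s)) (fderiv ℝ (fderiv ℝ x) (t, s) (1, 0)) t :=
      hD.comp_hasDerivAt t hline₁
    simpa using h1.clm_apply (hasDerivAt_const t ((0 : ℝ), (1 : ℝ)))
  have hsymm : fderiv ℝ (fderiv ℝ x) (t, s) (1, 0) (0, 1) =
      fderiv ℝ (fderiv ℝ x) (t, s) (0, 1) (1, 0) :=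
    ((hxat _ hq).isSymmSndFDerivAt (by
      rw [minSmoothness_of_isRCLikeNormedField]; 
      exact WithTop.coe_le_coe.2 (le_top : (2 : ℕ∞) ≤ ⊤))) _ _
  have hη₂ : HasDerivAt (fun σ => fderiv ℝ x (t, σ) (1, 0))
      (fderiv ℝ (fderiv ℝ x) (t, s) (0, 1) (1, 0)) s := by
    have h1 : HasDerivAt (fun σ => fderiv ℝ x (t, σ)) (fderiv ℝ (fderiv ℝ x) (t, s) (0, 1)) s :=
      hD.comp_hasDerivAt s (hline₂ s)
    simpa using h1.clm_apply (hasDerivAt_const s ((1 : ℝ), (0 : ℝ)))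
  have hvel : ∀ q ∈ O, fderiv ℝ x q (1, 0) = ∑ k, ξ q (V k (x q)) • V k (x q) := by
    intro q hq
    have h1 := ((hxat q hq).differentiableAt (by simp)).hasFDerivAt.comp_hasDerivAt q.1
      ((hasDerivAt_id q.1).prodMk (hasDerivAt_const q.1 q.2))
    exact h1.unique (hx q hq)
  have hnear : ∀ᶠ σ in 𝓝 s, (t, σ) ∈ O :=
    (hline₂ s).continuousAt.eventually (hO.mem_nhds hq)
  have hxσ : HasDerivAt (fun σ => x (t, σ)) (fderiv ℝ x (t, s) (0, 1)) s :=
    ((hxat _ hq).differentiableAt (by simp)).hasFDerivAt.comp_hasDerivAt s (hline₂ s)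
  have hξσ : HasDerivAt (fun σ => ξ (t, σ)) (fderiv ℝ ξ (t, s) (0, 1)) s :=
    ((hξs.contDiffAt (hO.mem_nhds hq)).differentiableAt
      (by simp)).hasFDerivAt.comp_hasDerivAt s (hline₂ s)
  have hVσ : ∀ k, HasDerivAt (fun σ => V k (x (t, σ)))
      (fderiv ℝ (V k) (x (t, s)) (fderiv ℝ x (t, s) (0, 1))) s := fun k =>
    (hV k _).hasFDerivAt.comp_hasDerivAt s hxσ
  obtain ⟨u', hu'⟩ : ∃ u' : κ → ℝ, ∀ k, HasDerivAt (fun σ => ξ (t, σ) (V k (x (t, σ)))) (u' k) s :=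
    ⟨_, fun k => hξσ.clm_apply (hVσ k)⟩
  have hR : HasDerivAt (fun σ => ∑ k, ξ (t, σ) (V k (x (t, σ))) • V k (x (t, σ)))
      (∑ k, (ξ (t, s) (V k (x (t, s))) •
        fderiv ℝ (V k) (x (t, s)) (fderiv ℝ x (t, s) (0, 1)) + u' k • V k (x (t, s)))) s :=
    HasDerivAt.fun_sum fun k _ => (hu' k).smul (hVσ k)
  have hR' := hη₂.unique (hR.congr_of_eventuallyEq (hnear.mono fun σ hσ => hvel _ hσ))
  have hsum : ∑ k, u' k * ξ (t, s) (V k (x (t, s))) = 0 := by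
    have h1 : HasDerivAt (fun σ => ∑ k, ξ (t, σ) (V k (x (t, σ))) ^ 2)
        (∑ k, (2 : ℕ) * ξ (t, s) (V k (x (t, s))) ^ (2 - 1) * u' k) s :=
      HasDerivAt.fun_sum fun k _ => (hu' k).pow 2
    have h2 := h1.unique ((hasDerivAt_const s (1 : ℝ)).congr_of_eventuallyEq
      (hnear.mono fun σ hσ => hE _ hσ))
    have h3 : ∑ k, (2 : ℕ) * ξ (t, s) (V k (x (t, s))) ^ (2 - 1) * u' k =
        2 * ∑ k, u' k * ξ (t, s) (V k (x (t, s))) := by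
      rw [Finset.mul_sum]
      refine Finset.sum_congr rfl fun k _ => ?_
      push_cast
      ring
    rw [h3] at h2
    linarith
  have hmain := (hξ _ hq).clm_apply hη
  convert! hmain using 1
  rw [hsymm, hR']
  simp only [map_sum, map_add, map_smul, smul_eq_mul, Finset.sum_add_distrib, hsum]
  simp

end Conservation

/-! ### Characteristics issued from a noncharacteristic hypersurface -/

section Characteristics

variable {E : Type*} [NormedAddCommGroup E] [NormedSpace ℝ E] {κ : Type*} [Fintype κ]

lemma hasDerivAt_comp_fst {F G : Type*} [NormedAddCommGroup F] [NormedSpace ℝ F]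
    [NormedAddCommGroup G] [NormedSpace ℝ G] {u : ℝ → F × G} {u' : F × G} {t : ℝ}
    (h : HasDerivAt u u' t) : HasDerivAt (fun s => (u s).1) u'.1 t :=
  (ContinuousLinearMap.fst ℝ F G).hasFDerivAt.comp_hasDerivAt t h

lemma hasDerivAt_comp_snd {F G : Type*} [NormedAddCommGroup F] [NormedSpace ℝ F]
    [NormedAddCommGroup G] [NormedSpace ℝ G] {u : ℝ → F × G} {u' : F × G} {t : ℝ}
    (h : HasDerivAt u u' t) : HasDerivAt (fun s => (u s).2) u'.2 t :=
  (ContinuousLinearMap.snd ℝ F G).hasFDerivAt.comp_hasDerivAt t h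

/-- The Hamiltonian vector field of `½ ∑ ξ(Z k)²`, for fields depending on a real parameter. -/
def hamField (Z : κ → ℝ × E → E) (q : ℝ × E × (E →L[ℝ] ℝ)) : E × (E →L[ℝ] ℝ) :=
  (∑ k, q.2.2 (Z k (q.1, q.2.1)) • Z k (q.1, q.2.1),
    -∑ k, q.2.2 (Z k (q.1, q.2.1)) • q.2.2.comp (fderiv ℝ (fun y => Z k (q.1, y)) q.2.1))

lemma contDiff_hamField {Z : κ → ℝ × E → E} (hZ : ∀ k, ContDiff ℝ ∞ (Z k)) :
    ContDiff ℝ ∞ (hamField Z) := by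
  have h1 : ∀ k, ContDiff ℝ ∞ (fun q : ℝ × E × (E →L[ℝ] ℝ) => Z k (q.1, q.2.1)) := fun k =>
    (hZ k).comp (contDiff_fst.prodMk contDiff_snd.fst)
  have h2 : ∀ k, ContDiff ℝ ∞ (fun q : ℝ × E × (E →L[ℝ] ℝ) => q.2.2 (Z k (q.1, q.2.1))) :=
    fun k => contDiff_snd.snd.clm_apply (h1 k)
  have h3 : ∀ k, ContDiff ℝ ∞ (fun q : ℝ × E × (E →L[ℝ] ℝ) =>
      fderiv ℝ (fun y => Z k (q.1, y)) q.2.1) := fun k =>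
    ContDiff.fderiv (f := fun (q : ℝ × E × (E →L[ℝ] ℝ)) y => Z k (q.1, y)) (m := ∞)
      ((hZ k).comp (contDiff_fst.fst.prodMk contDiff_snd)) contDiff_snd.fst (by simp)
  exact (ContDiff.sum fun k _ => (h2 k).smul (h1 k)).prodMk
    (ContDiff.sum fun k _ => (h2 k).smul (contDiff_snd.snd.clm_comp (h3 k))).neg

/-- The squared norm of the differential of `f` in the directions `Z`. -/
def gradSq (Z : κ → ℝ × E → E) (f : E → ℝ) (a : ℝ × E) : ℝ :=
  ∑ k, fderiv ℝ f a.2 (Z k a) ^ 2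

lemma contDiff_gradSq {Z : κ → ℝ × E → E} (hZ : ∀ k, ContDiff ℝ ∞ (Z k)) {f : E → ℝ}
    (hf : ContDiff ℝ ∞ f) : ContDiff ℝ ∞ (gradSq Z f) :=
  ContDiff.sum fun k _ =>
    (((hf.fderiv_right (m := ∞) (by simp)).comp contDiff_snd).clm_apply (hZ k)).pow 2

/-- The unit covector normal to the level sets of `f`, pointing to the sublevel sets. -/
def unitConormal (Z : κ → ℝ × E → E) (f : E → ℝ) (a : ℝ × E) : E →L[ℝ] ℝ :=
  -(Real.sqrt (gradSq Z f a))⁻¹ • fderiv ℝ f a.2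

lemma contDiffOn_unitConormal {Z : κ → ℝ × E → E} (hZ : ∀ k, ContDiff ℝ ∞ (Z k)) {f : E → ℝ}
    (hf : ContDiff ℝ ∞ f) : ContDiffOn ℝ ∞ (unitConormal Z f) {a | 0 < gradSq Z f a} := by
  have h1 : ContDiffOn ℝ ∞ (fun a => Real.sqrt (gradSq Z f a)) {a | 0 < gradSq Z f a} :=
    (contDiff_gradSq hZ hf).contDiffOn.sqrt fun a ha => (ne_of_gt ha)
  exact (h1.inv fun a ha => (Real.sqrt_pos.2 ha).ne').neg.smul
    ((hf.fderiv_right (m := ∞) (by simp)).comp contDiff_snd).contDiffOn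

lemma sum_unitConormal_sq {Z : κ → ℝ × E → E} {f : E → ℝ} {a : ℝ × E}
    (ha : 0 < gradSq Z f a) : ∑ k, unitConormal Z f a (Z k a) ^ 2 = 1 := by
  have h : ∀ k, unitConormal Z f a (Z k a) ^ 2 =
      (gradSq Z f a)⁻¹ * fderiv ℝ f a.2 (Z k a) ^ 2 := by
    intro k
    simp only [unitConormal, _root_.smul_apply, smul_eq_mul, mul_pow, neg_sq,
      inv_pow, Real.sq_sqrt ha.le]
  simp_rw [h]
  rw [← Finset.mul_sum]
  exact inv_mul_cancel₀ ha.ne'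

/-- The last clause is the Gauss lemma: the transported covector kills variations that come from
moving the starting point along a level set of `f`. The pairing is conserved in time and vanishes at
time `0`, where `ξ` is a multiple of `df`. The strict inequality says that characteristics cross the
level sets downwards. -/
lemma exists_characteristics [CompleteSpace E] {Z : κ → ℝ × E → E}
    (hZ : ∀ k, ContDiff ℝ ∞ (Z k)) {f : E → ℝ} (hf : ContDiff ℝ ∞ f) {ε₀ : ℝ} {p : E}
    (hp : 0 < gradSq Z f (ε₀, p)) {A : Set E} (hA : A ∈ 𝓝 p) :
    ∃ r > 0, ∃ (x : ℝ × ℝ × E → E) (ξ : ℝ × ℝ × E → E →L[ℝ] ℝ),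
      ContDiffOn ℝ ∞ x (Metric.ball (0, ε₀, p) r) ∧ ContDiffOn ℝ ∞ ξ (Metric.ball (0, ε₀, p) r) ∧
      ∀ q ∈ Metric.ball ((0 : ℝ), ε₀, p) r,
        HasDerivAt (fun t => x (t, q.2))
          (∑ k, ξ q (Z k (q.2.1, x q)) • Z k (q.2.1, x q)) q.1 ∧
        x (0, q.2) = q.2.2 ∧ ∑ k, ξ q (Z k (q.2.1, x q)) ^ 2 = 1 ∧
        fderiv ℝ f (x q) (∑ k, ξ q (Z k (q.2.1, x q)) • Z k (q.2.1, x q)) < 0 ∧ x q ∈ A ∧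
        ∀ v, fderiv ℝ f q.2.2 v = 0 → ξ q (fderiv ℝ x q (0, 0, v)) = 0 := by
  set ξ₀ := unitConormal Z f with hξ₀
  obtain ⟨r, hr, Φ, hΦ, hflow⟩ := exists_smooth_local_flow_param (contDiff_hamField hZ) ε₀
    (p, ξ₀ (ε₀, p))
  set N : Set (ℝ × ℝ × E) := {q | 0 < gradSq Z f q.2} with hN
  have hNo : IsOpen N := isOpen_lt continuous_const
    ((contDiff_gradSq hZ hf).continuous.comp continuous_snd)
  set m : ℝ × ℝ × E → ℝ × ℝ × E × (E →L[ℝ] ℝ) := fun q => (q.1, q.2.1, q.2.2, ξ₀ q.2) with hm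
  have hms : ContDiffOn ℝ ∞ m N :=
    contDiffOn_fst.prodMk (contDiffOn_snd.fst.prodMk (contDiffOn_snd.snd.prodMk
      ((contDiffOn_unitConormal hZ hf).comp contDiffOn_snd fun q hq => hq)))
  set O : Set (ℝ × ℝ × E) := N ∩ m ⁻¹' Metric.ball (0, ε₀, p, ξ₀ (ε₀, p)) r with hO
  have hOo : IsOpen O := hms.continuousOn.isOpen_inter_preimage hNo Metric.isOpen_ball
  set Ψ : ℝ × ℝ × E → E × (E →L[ℝ] ℝ) := fun q => Φ (m q) with hΨdef
  have hΨ : ContDiffOn ℝ ∞ Ψ O := hΦ.comp (hms.mono inter_subset_left) fun q hq => hq.2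
  have hO0 : (0, ε₀, p) ∈ O := ⟨hp, Metric.mem_ball_self hr⟩
  have hfl : ∀ q ∈ O, HasDerivAt (fun t => Ψ (t, q.2)) (hamField Z (q.2.1, Ψ q)) q.1 ∧
      Ψ (0, q.2) = (q.2.2, ξ₀ q.2) := by
    rintro ⟨t, ε, y⟩ ⟨-, hq⟩
    simp only [hm, mem_preimage, Metric.mem_ball, Prod.dist_eq, max_lt_iff] at hq
    obtain ⟨h0, hd⟩ := hflow ε hq.2.1 (y, ξ₀ (ε, y)) (by
      rw [Metric.mem_ball, Prod.dist_eq]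
      exact max_lt hq.2.2.1 hq.2.2.2)
    exact ⟨hd t (by simpa using hq.1), h0⟩
  have hΨ0 : Ψ (0, ε₀, p) = (p, ξ₀ (ε₀, p)) := (hfl _ hO0).2
  set D : ℝ × ℝ × E → ℝ := fun q => fderiv ℝ f (Ψ q).1 (hamField Z (q.2.1, Ψ q)).1 with hD
  have hDc : ContinuousOn D O := by
    have h1 : ContinuousOn (fun q => hamField Z (q.2.1, Ψ q)) O :=
      (contDiff_hamField hZ).continuous.comp_continuousOn
        (continuousOn_snd.fst.prodMk hΨ.continuousOn)
    exact ((hf.continuous_fderiv (by simp)).comp_continuousOn hΨ.continuousOn.fst).clm_apply h1.fst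
  have hD0 : D (0, ε₀, p) < 0 := by
    -- The initial velocity is built from the conormal itself, so `df` of it is minus the norm of
    -- the gradient.
    have h1 : D (0, ε₀, p) = -(Real.sqrt (gradSq Z f (ε₀, p)))⁻¹ * gradSq Z f (ε₀, p) := by
      simp only [hD, hΨ0, hamField, map_sum, map_smul, hξ₀, unitConormal, gradSq,
        _root_.smul_apply, smul_eq_mul, Finset.mul_sum]
      exact Finset.sum_congr rfl fun k _ => by ring
    rw [h1, neg_mul, neg_lt_zero]
    exact mul_pos (inv_pos.2 (Real.sqrt_pos.2 hp)) hp
  have hnhds : O ∩ {q | D q < 0 ∧ (Ψ q).1 ∈ A} ∈ 𝓝 ((0 : ℝ), ε₀, p) := by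
    refine inter_mem (hOo.mem_nhds hO0) (inter_mem ?_ ?_)
    · exact (hDc.continuousAt (hOo.mem_nhds hO0)).eventually_lt_const hD0
    · have h1 : ContinuousAt (fun q => (Ψ q).1) (0, ε₀, p) :=
        (hΨ.continuousOn.continuousAt (hOo.mem_nhds hO0)).fst
      refine h1.preimage_mem_nhds ?_
      rwa [hΨ0]
  obtain ⟨ρ, hρ, hρsub⟩ := Metric.mem_nhds_iff.1 hnhds
  have hBO : Metric.ball ((0 : ℝ), ε₀, p) ρ ⊆ O := fun q hq => (hρsub hq).1
  have hseg : ∀ q ∈ Metric.ball ((0 : ℝ), ε₀, p) ρ, |q.1| < ρ ∧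
      ∀ t ∈ Metric.ball (0 : ℝ) ρ, (t, q.2) ∈ Metric.ball ((0 : ℝ), ε₀, p) ρ := by
    rintro ⟨t, a⟩ hq
    rw [← ball_prod_same] at hq ⊢
    exact ⟨by simpa using hq.1, fun s hs => ⟨hs, hq.2⟩⟩
  have hconst : ∀ (u : ℝ → ℝ), (∀ t ∈ Metric.ball (0 : ℝ) ρ, HasDerivAt u 0 t) →
      ∀ t ∈ Metric.ball (0 : ℝ) ρ, u t = u 0 := by
    intro u hu t ht
    refine (convex_ball (0 : ℝ) ρ).is_const_of_fderivWithin_eq_zero (𝕜 := ℝ)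
      (fun s hs => (hu s hs).differentiableAt.differentiableWithinAt) (fun s hs => ?_) ht
      (Metric.mem_ball_self hρ)
    rw [((hu s hs).hasFDerivAt.hasFDerivWithinAt).fderivWithin
      (Metric.isOpen_ball.uniqueDiffWithinAt hs)]
    ext
    simp
  have hdiffV : ∀ (ε : ℝ) k, Differentiable ℝ (fun y => Z k (ε, y)) := fun ε k =>
    ((hZ k).comp (contDiff_const.prodMk contDiff_id)).differentiable (by simp)
  have hx' : ∀ q ∈ O, HasDerivAt (fun t => (Ψ (t, q.2)).1)
      (∑ k, (Ψ q).2 (Z k (q.2.1, (Ψ q).1)) • Z k (q.2.1, (Ψ q).1)) q.1 := fun q hq =>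
    hasDerivAt_comp_fst (hfl q hq).1
  have hξ' : ∀ q ∈ O, HasDerivAt (fun t => (Ψ (t, q.2)).2)
      (-∑ k, (Ψ q).2 (Z k (q.2.1, (Ψ q).1)) •
        (Ψ q).2.comp (fderiv ℝ (fun y => Z k (q.2.1, y)) (Ψ q).1)) q.1 := fun q hq =>
    hasDerivAt_comp_snd (hfl q hq).1
  have henergy : ∀ q ∈ Metric.ball ((0 : ℝ), ε₀, p) ρ,
      ∑ k, (Ψ q).2 (Z k (q.2.1, (Ψ q).1)) ^ 2 = 1 := by
    intro q hq
    have h1 := hconst (fun t => ∑ k, (Ψ (t, q.2)).2 (Z k (q.2.1, (Ψ (t, q.2)).1)) ^ 2)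
      (fun t ht => hasDerivAt_energy (V := fun k y => Z k (q.2.1, y)) (hdiffV q.2.1)
        (hx' (t, q.2) (hBO ((hseg q hq).2 t ht))) (hξ' (t, q.2) (hBO ((hseg q hq).2 t ht))))
      q.1 (by simpa using (hseg q hq).1)
    simp only [(hfl q (hBO hq)).2] at h1
    exact h1.trans (sum_unitConormal_sq (hBO hq).1)
  have hΨ1 : ContDiffOn ℝ ∞ (fun q => (Ψ q).1) O := hΨ.fst
  have hΨ2 : ContDiffOn ℝ ∞ (fun q => (Ψ q).2) O := hΨ.snd
  refine ⟨ρ, hρ, fun q => (Ψ q).1, fun q => (Ψ q).2, hΨ1.mono hBO, hΨ2.mono hBO,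
    fun q hq => ⟨hx' q (hBO hq), congrArg Prod.fst (hfl q (hBO hq)).2, henergy q hq, (hρsub hq).2.1,
      (hρsub hq).2.2, ?_⟩⟩
  intro v hv
  obtain ⟨t, ε, y⟩ := q
  -- A two-parameter slice through `y` in the direction `v`, with `ε` frozen, to which
  -- `hasDerivAt_momentum` applies.
  set j : ℝ × ℝ → ℝ × ℝ × E := fun a => (a.1, ε, y + a.2 • v) with hj
  have hjs : ContDiff ℝ ∞ j := contDiff_fst.prodMk (contDiff_const.prodMk
    (contDiff_const.add (contDiff_snd.smul contDiff_const)))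
  have hj' : ∀ a, HasFDerivAt j ((ContinuousLinearMap.fst ℝ ℝ ℝ).prod
      ((0 : ℝ × ℝ →L[ℝ] ℝ).prod ((ContinuousLinearMap.snd ℝ ℝ ℝ).smulRight v))) a := fun a =>
    hasFDerivAt_fst.prodMk ((hasFDerivAt_const _ _).prodMk
      ((hasFDerivAt_snd.smul_const v).const_add y))
  have hj0 : ∀ s, j (s, 0) = (s, ε, y) := fun s => by simp [hj]
  set B := j ⁻¹' Metric.ball (0, ε₀, p) ρ with hB
  have hBo : IsOpen B := Metric.isOpen_ball.preimage hjs.continuous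
  have hmom : ∀ s ∈ Metric.ball (0 : ℝ) ρ, HasDerivAt (fun t => (Ψ (j (t, 0))).2
      (fderiv ℝ (fun a => (Ψ (j a)).1) (t, 0) (0, 1))) 0 s := by
    intro s hs
    have hsB : (s, (0 : ℝ)) ∈ B := by
      rw [hB, mem_preimage, hj0]
      exact (hseg _ hq).2 s hs
    exact hasDerivAt_momentum (V := fun k y => Z k (ε, y)) (hdiffV ε) hBo
      (x := fun a => (Ψ (j a)).1) (ξ := fun a => (Ψ (j a)).2)
      (hΨ1.comp hjs.contDiffOn fun a ha => hBO ha) (hΨ2.comp hjs.contDiffOn fun a ha => hBO ha)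
      (fun a ha => hx' (j a) (hBO ha)) (fun a ha => hξ' (j a) (hBO ha))
      (fun a ha => henergy (j a) ha) hsB
  have hchain : ∀ s ∈ Metric.ball (0 : ℝ) ρ, fderiv ℝ (fun a => (Ψ (j a)).1) (s, 0) (0, 1) =
      fderiv ℝ (fun q => (Ψ q).1) (s, ε, y) (0, 0, v) := by
    intro s hs
    have h1 : HasFDerivAt (fun q => (Ψ q).1) (fderiv ℝ (fun q => (Ψ q).1) (s, ε, y)) (j (s, 0)) := by
      rw [hj0]
      exact ((hΨ1.contDiffAt (hOo.mem_nhds (hBO ((hseg _ hq).2 s hs)))).differentiableAt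
        (by simp)).hasFDerivAt
    have h2 : HasFDerivAt (fun a => (Ψ (j a)).1) _ (s, (0 : ℝ)) := h1.comp (s, (0 : ℝ)) (hj' _)
    rw [h2.fderiv]
    simp
  have hfin := hconst _ hmom t (by simpa using (hseg _ hq).1)
  have h0ball : (0 : ℝ) ∈ Metric.ball (0 : ℝ) ρ := Metric.mem_ball_self hρ
  -- At time `0` the endpoint is the starting point, so the initial variation is `v` itself.
  have hinit : fderiv ℝ (fun q => (Ψ q).1) (0, ε, y) (0, 0, v) = v := by
    rw [← hchain 0 h0ball]
    have h1 : HasFDerivAt (fun a => (Ψ (j a)).1) (fderiv ℝ (fun a => (Ψ (j a)).1) (0, 0))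
        ((0 : ℝ), (0 : ℝ)) := by
      refine ((ContDiffOn.contDiffAt (s := B) (n := ∞) ?_ ?_).differentiableAt
        (by simp)).hasFDerivAt
      · exact hΨ1.comp hjs.contDiffOn fun a ha => hBO ha
      · refine hBo.mem_nhds ?_
        rw [hB, mem_preimage, hj0]
        exact (hseg _ hq).2 0 h0ball
    have h2 := h1.comp_hasDerivAt (0 : ℝ)
      ((hasDerivAt_const (0 : ℝ) (0 : ℝ)).prodMk (hasDerivAt_id (0 : ℝ)))
    have h3 : HasDerivAt (fun s : ℝ => y + s • v) ((1 : ℝ) • v) 0 :=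
      ((hasDerivAt_id (0 : ℝ)).smul_const v).const_add y
    rw [one_smul] at h3
    refine h2.unique (h3.congr_of_eventuallyEq ?_)
    have hev : ∀ᶠ s : ℝ in 𝓝 0, ((0 : ℝ), s) ∈ B := by
      have : ContinuousAt (fun s : ℝ => ((0 : ℝ), s)) 0 := by fun_prop
      refine this.eventually (hBo.mem_nhds ?_)
      rw [hB, mem_preimage, hj0]
      exact (hseg _ hq).2 0 h0ball
    filter_upwards [hev] with s hs
    exact congrArg Prod.fst (hfl (j (0, s)) (hBO hs)).2
  rw [hj0, hj0, hchain t (by simpa using (hseg _ hq).1), hchain 0 h0ball, hinit] at hfin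
  refine hfin.trans ?_
  rw [(hfl _ (hBO hq)).2]
  simp only [hξ₀, unitConormal, _root_.smul_apply]
  rw [hv, smul_zero]

end Characteristics

/-! ### Local solutions of the eikonal equation -/

section Eikonal

variable {E : Type*} [NormedAddCommGroup E] [NormedSpace ℝ E]

/-- The linear automorphism `(a, b, c) ↦ (a, ℓ c, b v + c)` for a vector `v` transverse to the
kernel of `ℓ`. -/
def transverseEquiv (l : E →L[ℝ] ℝ) (v : E) (h : l v ≠ 0) : (ℝ × ℝ × E) ≃L[ℝ] (ℝ × ℝ × E) where
  toFun q := (q.1, l q.2.2, q.2.1 • v + q.2.2)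
  invFun q := (q.1, (l q.2.2 - q.2.1) / l v, q.2.2 - ((l q.2.2 - q.2.1) / l v) • v)
  map_add' p q := by
    refine Prod.ext rfl (Prod.ext (map_add l _ _) ?_)
    simp only [Prod.fst_add, Prod.snd_add, add_smul]
    abel
  map_smul' c q := by
    refine Prod.ext rfl (Prod.ext (map_smul l _ _) ?_)
    simp only [Prod.smul_fst, Prod.smul_snd, smul_eq_mul, mul_smul, RingHom.id_apply, smul_add]
  left_inv q := by
    have : (l (q.2.1 • v + q.2.2) - l q.2.2) / l v = q.2.1 := by
      rw [map_add, map_smul, smul_eq_mul]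
      field_simp
      ring
    refine Prod.ext rfl (Prod.ext this ?_)
    simp only [this]
    abel
  right_inv q := by
    refine Prod.ext rfl (Prod.ext ?_ ?_)
    · simp only [map_sub, map_smul, smul_eq_mul]
      field_simp
      ring
    · simp only
      abel
  continuous_toFun := by fun_prop
  continuous_invFun := by fun_prop

lemma hasFDerivAt_partial {F : Type*} [NormedAddCommGroup F] [NormedSpace ℝ F] {g : ℝ × E → F}
    {W : Set (ℝ × E)} (hW : IsOpen W) (hg : ContDiffOn ℝ ∞ g W) {ε : ℝ} {x : E}
    (h : (ε, x) ∈ W) :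
    HasFDerivAt (fun x' => g (ε, x')) (fderiv ℝ (fun x' => g (ε, x')) x) x := by
  have h1 := (hg.contDiffAt (hW.mem_nhds h)).comp x
    (f := fun x' => (ε, x')) (contDiffAt_const.prodMk contDiffAt_id)
  exact (h1.differentiableAt (by simp)).hasFDerivAt

variable {κ : Type*} [Fintype κ]

/-- The map `(ε, t, y) ↦ (ε, f y, X (t, ε, y))` is locally invertible because the initial velocity
is transverse to `ker df`. Inverting it over `(ε, 0, x)` finds the foot `y` on `{f = 0}` and the
arrival time `φ`, with no parametrisation of the hypersurface. The set `A` confines the curves to a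
region where the extended fields will be the true ones. -/
theorem exists_local_eikonal [CompleteSpace E] {Z : κ → ℝ × E → E}
    (hZ : ∀ k, ContDiff ℝ ∞ (Z k)) {f : E → ℝ} (hf : ContDiff ℝ ∞ f) {ε₀ : ℝ} {p : E}
    (hfp : f p = 0) (hp : 0 < gradSq Z f (ε₀, p)) {A : Set E} (hA : A ∈ 𝓝 p) :
    ∃ (W : Set (ℝ × E)) (φ : ℝ × E → ℝ), IsOpen W ∧ (ε₀, p) ∈ W ∧ ContDiffOn ℝ ∞ φ W ∧
      ∀ ε x, (ε, x) ∈ W →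
        ∑ k, fderiv ℝ (fun y => φ (ε, y)) x (Z k (ε, x)) ^ 2 = 1 ∧ (f x = 0 → φ (ε, x) = 0) ∧
        (f x ≤ 0 → 0 ≤ φ (ε, x) ∧ ∃ (γ : ℝ → E) (u : ℝ → κ → ℝ), f (γ 0) = 0 ∧ γ 0 ∈ A ∧
          γ (φ (ε, x)) = x ∧ ContDiffOn ℝ ∞ γ (Icc 0 (φ (ε, x))) ∧
          ContinuousOn u (Icc 0 (φ (ε, x))) ∧
          ∀ t ∈ Icc 0 (φ (ε, x)), γ t ∈ A ∧ HasDerivAt γ (∑ k, u t k • Z k (ε, γ t)) t ∧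
            ∑ k, u t k ^ 2 = 1 ∧ (0 < t → f (γ t) < 0)) := by
  obtain ⟨r, hr, X, ξ, hX, hξ, hall⟩ := exists_characteristics hZ hf hp hA
  set B := Metric.ball ((0 : ℝ), ε₀, p) r with hB
  have hBo : IsOpen B := Metric.isOpen_ball
  have hB0 : (0, ε₀, p) ∈ B := Metric.mem_ball_self hr
  have hXat : ∀ q ∈ B, HasFDerivAt X (fderiv ℝ X q) q := fun q hq =>
    ((hX.contDiffAt (hBo.mem_nhds hq)).differentiableAt (by simp)).hasFDerivAt
  have hvel : ∀ q ∈ B, fderiv ℝ X q (1, 0) = ∑ k, ξ q (Z k (q.2.1, X q)) • Z k (q.2.1, X q) := by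
    intro q hq
    have h1 := (hXat q hq).comp_hasDerivAt q.1
      ((hasDerivAt_id q.1).prodMk (hasDerivAt_const q.1 q.2))
    exact h1.unique (hall q hq).1
  set v := fderiv ℝ X (0, ε₀, p) (1, 0) with hv
  have hX0 : ∀ᶠ a in 𝓝 (ε₀, p), X (0, a) = a.2 := by
    have h1 : ContinuousAt (fun a : ℝ × E => ((0 : ℝ), a)) (ε₀, p) := by fun_prop
    filter_upwards [h1.eventually (hBo.mem_nhds hB0)] with a ha
    exact (hall _ ha).2.1
  have hXp : X (0, ε₀, p) = p := hX0.self_of_nhds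
  have hfv : fderiv ℝ f p v ≠ 0 := by
    have h1 := (hall _ hB0).2.2.2.1
    rw [← hvel _ hB0, hXp] at h1
    exact h1.ne
  have hDX : fderiv ℝ X (0, ε₀, p) = (ContinuousLinearMap.fst ℝ ℝ (ℝ × E)).smulRight v +
      (ContinuousLinearMap.snd ℝ ℝ E).comp (ContinuousLinearMap.snd ℝ ℝ (ℝ × E)) := by
    have h1 := (hXat _ hB0).comp (ε₀, p) (hasFDerivAt_prodMk_right (𝕜 := ℝ) (0 : ℝ) (ε₀, p))
    have h2 := h1.unique ((hasFDerivAt_snd (𝕜 := ℝ)).congr_of_eventuallyEq hX0)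
    refine ContinuousLinearMap.ext fun q => ?_
    have h3 : q = q.1 • ((1 : ℝ), (0 : ℝ × E)) + (0, q.2) := by simp
    have h4 := congrArg (fun T => T q.2) h2
    simp only [ContinuousLinearMap.comp_apply, ContinuousLinearMap.inr_apply] at h4
    conv_lhs => rw [h3, map_add, map_smul, h4]
    rfl
  set G : ℝ × ℝ × E → ℝ × ℝ × E := fun q => (q.1, f q.2.2, X (q.2.1, q.1, q.2.2)) with hG
  set s : ℝ × ℝ × E → ℝ × ℝ × E := fun q => (q.2.1, q.1, q.2.2) with hs
  have hss : ContDiff ℝ ∞ s := contDiff_snd.fst.prodMk (contDiff_fst.prodMk contDiff_snd.snd)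
  have hGs : ContDiffOn ℝ ∞ G (s ⁻¹' B) :=
    contDiffOn_fst.prodMk ((hf.comp contDiff_snd.snd).contDiffOn.prodMk
      (hX.comp hss.contDiffOn fun q hq => hq))
  have hG' : HasFDerivAt G (transverseEquiv (fderiv ℝ f p) v hfv :
      (ℝ × ℝ × E) →L[ℝ] (ℝ × ℝ × E)) (ε₀, 0, p) := by
    have hfst : HasFDerivAt (fun q : ℝ × ℝ × E => q.1) (ContinuousLinearMap.fst ℝ ℝ (ℝ × E))
      (ε₀, 0, p) := hasFDerivAt_fst
    have hsnd : HasFDerivAt (fun q : ℝ × ℝ × E => q.2) (ContinuousLinearMap.snd ℝ ℝ (ℝ × E))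
      (ε₀, 0, p) := hasFDerivAt_snd
    have h1 : HasFDerivAt s _ (ε₀, 0, p) := hsnd.fst.prodMk (hfst.prodMk hsnd.snd)
    have h2 : HasFDerivAt X (fderiv ℝ X (0, ε₀, p)) (s (ε₀, 0, p)) := hXat _ hB0
    have h3 : HasFDerivAt f (fderiv ℝ f p) ((ε₀, (0 : ℝ), p) : ℝ × ℝ × E).2.2 :=
      ((hf.differentiable (by simp)) p).hasFDerivAt
    have h4 := hfst.prodMk ((h3.comp (ε₀, (0 : ℝ), p) hsnd.snd).prodMk
      (h2.comp (ε₀, (0 : ℝ), p) h1))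
    refine h4.congr_fderiv (ContinuousLinearMap.ext fun q => ?_)
    rw [hDX]
    rfl
  obtain ⟨e, he, hmem, hsrc, hsymm⟩ := exists_smooth_localInverse
    (hBo.preimage hss.continuous) hGs (show (ε₀, (0 : ℝ), p) ∈ s ⁻¹' B from hB0) _ hG'
  set i : ℝ × E → ℝ × ℝ × E := fun a => (a.1, 0, a.2) with hi
  have his : ContDiff ℝ ∞ i := contDiff_fst.prodMk (contDiff_const.prodMk contDiff_snd)
  set W : Set (ℝ × E) := i ⁻¹' e.target with hW
  have hWo : IsOpen W := e.open_target.preimage his.continuous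
  have hinv : ContDiffOn ℝ ∞ (fun a => e.symm (i a)) W := hsymm.comp his.contDiffOn fun a ha => ha
  set φ : ℝ × E → ℝ := fun a => (e.symm (i a)).2.1 with hφ
  set y : ℝ × E → E := fun a => (e.symm (i a)).2.2 with hy
  have hφs : ContDiffOn ℝ ∞ φ W := hinv.snd.fst
  have hys : ContDiffOn ℝ ∞ y W := hinv.snd.snd
  have hsol : ∀ a ∈ W, (φ a, a.1, y a) ∈ B ∧ f (y a) = 0 ∧ X (φ a, a.1, y a) = a.2 := by
    intro a ha
    have h1 := e.right_inv ha
    rw [he] at h1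
    have h2 : (e.symm (i a)).1 = a.1 := congrArg Prod.fst h1
    have h3 := hsrc (e.map_target ha)
    have h4 : f (y a) = 0 := congrArg (fun q => q.2.1) h1
    have h5 : X (φ a, (e.symm (i a)).1, y a) = a.2 := congrArg (fun q => q.2.2) h1
    have h6 : (φ a, (e.symm (i a)).1, y a) ∈ B := h3
    rw [h2] at h5 h6
    exact ⟨h6, h4, h5⟩
  have hmemW : (ε₀, p) ∈ W := by
    have h1 := e.map_source hmem
    rw [he] at h1
    simp only [hG, hXp, hfp] at h1
    exact h1
  refine ⟨W, φ, hWo, hmemW, hφs, ?_⟩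
  intro ε x hεx
  obtain ⟨hqB, hfy, hXx⟩ := hsol _ hεx
  simp only at hqB hXx
  set τ := φ (ε, x) with hτ
  set z := y (ε, x) with hz
  have hseg : ∀ t, |t| ≤ |τ| → (t, ε, z) ∈ B := by
    intro t ht
    rw [hB, ← ball_prod_same] at hqB ⊢
    have h1 : |τ| < r := by simpa using hqB.1
    exact ⟨by simpa using ht.trans_lt h1, hqB.2⟩
  have hdf : ∀ t, (t, ε, z) ∈ B → HasDerivAt (fun t => f (X (t, ε, z)))
      (fderiv ℝ f (X (t, ε, z)) (∑ k, ξ (t, ε, z) (Z k (ε, X (t, ε, z))) •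
        Z k (ε, X (t, ε, z)))) t := fun t ht =>
    ((hf.differentiable (by simp)) _).hasFDerivAt.comp_hasDerivAt t (hall _ ht).1
  have hX0z : X (0, ε, z) = z := (hall _ hqB).2.1
  -- Since `f` vanishes at the foot and decreases along the characteristic, the sign of `f x`
  -- decides that of `τ`.
  have hanti : StrictAntiOn (fun t => f (X (t, ε, z))) (Icc (-|τ|) |τ|) := by
    refine strictAntiOn_of_deriv_neg (convex_Icc _ _) (fun t ht => ?_) fun t ht => ?_
    · exact (hdf t (hseg t (abs_le.2 ht))).continuousAt.continuousWithinAt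
    · have h0 : t ∈ Icc (-|τ|) |τ| := interior_subset ht
      have h1 := hseg t (abs_le.2 h0)
      rw [(hdf t h1).deriv]
      exact (hall _ h1).2.2.2.1
  have h0m : (0 : ℝ) ∈ Icc (-|τ|) |τ| := ⟨by simp, abs_nonneg _⟩
  have hτm : τ ∈ Icc (-|τ|) |τ| := ⟨neg_abs_le _, le_abs_self _⟩
  have hτnonneg : f x ≤ 0 → 0 ≤ τ := by
    intro hfx
    by_contra hneg
    have h1 := hanti hτm h0m (not_le.1 hneg)
    simp only [hX0z, hfy, hXx] at h1
    exact absurd hfx (not_le.2 h1)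
  refine ⟨?_, ?_, fun hfx => ⟨hτnonneg hfx, fun t => X (t, ε, z),
    fun t k => ξ (t, ε, z) (Z k (ε, X (t, ε, z))), ?_, ?_, hXx, ?_, ?_, ?_⟩⟩
  · have hφ' := hasFDerivAt_partial hWo hφs hεx
    have hy' := hasFDerivAt_partial hWo hys hεx
    have hnear : ∀ᶠ x' in 𝓝 x, (ε, x') ∈ W := by
      have h1 : ContinuousAt (fun x' : E => (ε, x')) x := by fun_prop
      exact h1.eventually (hWo.mem_nhds hεx)
    have hcomp := (hXat _ hqB).comp x (hφ'.prodMk ((hasFDerivAt_const ε x).prodMk hy'))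
    have hid := hcomp.unique ((hasFDerivAt_id x).congr_of_eventuallyEq
      (hnear.mono fun x' hx' => (hsol _ hx').2.2))
    have hfy' := (((hf.differentiable (by simp)) z).hasFDerivAt.comp x hy').unique
      ((hasFDerivAt_const (0 : ℝ) x).congr_of_eventuallyEq
        (hnear.mono fun x' hx' => (hsol _ hx').2.1))
    -- Apply `ξ` to the derivative of the identity `X (φ, ε, y) = x`: it equals `1` on the velocity,
    -- by unit energy, and kills the contribution of the foot, which moves tangentially to a level
    -- set of `f`. The eikonal equation is then energy conservation.
    have hgrad : fderiv ℝ (fun x' => φ (ε, x')) x = ξ (τ, ε, z) := by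
      refine ContinuousLinearMap.ext fun w => ?_
      have h1 : fderiv ℝ X (τ, ε, z) (fderiv ℝ (fun x' => φ (ε, x')) x w, 0,
          fderiv ℝ (fun x' => y (ε, x')) x w) = w := congrArg (fun T => T w) hid
      have h2 : fderiv ℝ f z (fderiv ℝ (fun x' => y (ε, x')) x w) = 0 :=
        congrArg (fun T => T w) hfy'
      have h3 := (hall _ hqB).2.2.2.2.2 _ h2
      have h4 : ((fderiv ℝ (fun x' => φ (ε, x')) x w, 0,
          fderiv ℝ (fun x' => y (ε, x')) x w) : ℝ × ℝ × E) =
          fderiv ℝ (fun x' => φ (ε, x')) x w • ((1 : ℝ), (0 : ℝ × E)) +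
            (0, 0, fderiv ℝ (fun x' => y (ε, x')) x w) := by
        simp
      have h5 : ξ (τ, ε, z) (fderiv ℝ X (τ, ε, z) (1, 0)) = 1 := by
        rw [hvel _ hqB, map_sum, ← (hall _ hqB).2.2.1]
        refine Finset.sum_congr rfl fun k _ => ?_
        rw [map_smul, smul_eq_mul, sq]
      rw [h4, map_add, map_smul] at h1
      have h6 := congrArg (ξ (τ, ε, z)) h1
      rw [map_add, map_smul, h3, h5] at h6
      simpa using h6
    rw [hgrad]
    have h1 := (hall _ hqB).2.2.1
    simp only [hXx] at h1
    exact h1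
  · intro hfx
    refine hanti.injOn hτm h0m ?_
    simp only [hX0z, hfy, hXx, hfx]
  · simp only [hX0z, hfy]
  · exact (hall _ (hseg 0 (by simp))).2.2.2.2.1
  · exact hX.comp (contDiffOn_id.prodMk contDiffOn_const) fun t ht =>
      hseg t (by rw [abs_of_nonneg ht.1]; exact ht.2.trans (le_abs_self _))
  · have hmaps : MapsTo (fun t => (t, ε, z)) (Icc 0 τ) B := fun t ht =>
      hseg t (by rw [abs_of_nonneg ht.1]; exact ht.2.trans (le_abs_self _))
    have hc : ContinuousOn (fun t : ℝ => (t, ε, z)) (Icc 0 τ) := by fun_prop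
    refine continuousOn_pi.2 fun k => (hξ.continuousOn.comp hc hmaps).clm_apply
      ((hZ k).continuous.comp_continuousOn
        (continuousOn_const.prodMk (hX.continuousOn.comp hc hmaps)))
  · intro t ht
    have habs : |t| ≤ |τ| := by
      rw [abs_of_nonneg ht.1]
      exact ht.2.trans (le_abs_self _)
    have h1 := hall _ (hseg t habs)
    refine ⟨h1.2.2.2.2.1, h1.1, h1.2.2.1, fun htpos => ?_⟩
    have h2 := hanti h0m (abs_le.1 habs) htpos
    simpa only [hX0z, hfy] using h2

end Eikonal

/-! ### The norm of a frame -/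

section FrameNorm

variable {E : Type*} [NormedAddCommGroup E] [NormedSpace ℝ E]
variable {M : Type*} [TopologicalSpace M] [ChartedSpace E M] {ι : Type*} [Fintype ι]

lemma frameNorm_le (X : ι → (x : M) → TangentSpace 𝓘(ℝ, E) x) (x : M) (u : ι → ℝ) :
    frameNorm X x (∑ i, u i • X i x) ≤ Real.sqrt (∑ i, u i ^ 2) := by
  refine Real.sqrt_le_sqrt (csInf_le ⟨0, ?_⟩ ⟨u, rfl, rfl⟩)
  rintro s ⟨w, -, rfl⟩
  positivity

/-- Cauchy–Schwarz bounds the left side for every control representing the vector, hence for the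
infimum; the given `u` makes that infimum run over a nonempty set. -/
lemma abs_le_frameNorm {X : ι → (x : M) → TangentSpace 𝓘(ℝ, E) x} {x : M}
    (l : TangentSpace 𝓘(ℝ, E) x →ₗ[ℝ] ℝ) {C : ℝ} (hC : 0 < C) (h : ∑ i, l (X i x) ^ 2 ≤ C ^ 2)
    (u : ι → ℝ) : |l (∑ i, u i • X i x)| ≤ C * frameNorm X x (∑ i, u i • X i x) := by
  have hsq : (l (∑ i, u i • X i x) / C) ^ 2 ≤
      sInf {s : ℝ | ∃ w : ι → ℝ, ∑ i, w i • X i x = ∑ i, u i • X i x ∧ s = ∑ i, w i ^ 2} := by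
    refine le_csInf ⟨_, u, rfl, rfl⟩ ?_
    rintro s ⟨w, hw, rfl⟩
    rw [div_pow, div_le_iff₀ (by positivity), ← hw, map_sum]
    simp only [map_smul, smul_eq_mul]
    exact (Finset.sum_mul_sq_le_sq_mul_sq _ _ _).trans (by gcongr)
  have := Real.abs_le_sqrt hsq
  rw [abs_div, abs_of_pos hC, div_le_iff₀ hC, mul_comm] at this
  exact this

end FrameNorm

/-! ### Fields and curves in a chart -/

section Charts

variable {E : Type*} [NormedAddCommGroup E] [NormedSpace ℝ E]
variable {M : Type*} [TopologicalSpace M] [ChartedSpace E M] {ι : Type*}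

/-- The coordinates of tangent vectors at `x` in the chart at `p`. -/
def chartVel (p x : M) : TangentSpace 𝓘(ℝ, E) x →L[ℝ] E :=
  mfderiv 𝓘(ℝ, E) 𝓘(ℝ, E) (chartAt E p) x

/-- The coordinate expression of a vector field in the chart at `p`. -/
def coordField (p : M) (V : (x : M) → TangentSpace 𝓘(ℝ, E) x) (y : E) : E :=
  chartVel p ((chartAt E p).symm y) (V ((chartAt E p).symm y))

lemma coordField_chartAt (p : M) (V : (x : M) → TangentSpace 𝓘(ℝ, E) x) {x : M}
    (hx : x ∈ (chartAt E p).source) : coordField p V (chartAt E p x) = chartVel p x (V x) := by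
  rw [coordField, (chartAt E p).left_inv hx]

variable [IsManifold 𝓘(ℝ, E) ∞ M]

lemma contDiffOn_coordField (p : M) {V : (x : M) → TangentSpace 𝓘(ℝ, E) x}
    (hV : IsSmoothField V) : ContDiffOn ℝ ∞ (coordField p V) (chartAt E p).target := by
  set e := chartAt E p
  refine (contMDiffOn_vectorSpace_iff_contDiffOn (𝕜 := ℝ) (E := E) (V := coordField p V)).1 ?_
  have h1 : ContMDiffOn 𝓘(ℝ, E).tangent 𝓘(ℝ, E).tangent ∞
      (tangentMapWithin 𝓘(ℝ, E) 𝓘(ℝ, E) e e.source)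
      (Bundle.TotalSpace.proj ⁻¹' e.source) :=
    (contMDiffOn_chart (n := ∞) (x := p)).contMDiffOn_tangentMapWithin (by simp)
      e.open_source.uniqueMDiffOn
  have h2 : ContMDiffOn 𝓘(ℝ, E) 𝓘(ℝ, E).tangent ∞
      (fun y => (⟨e.symm y, V (e.symm y)⟩ : TangentBundle 𝓘(ℝ, E) M)) e.target :=
    hV.comp_contMDiffOn (contMDiffOn_chart_symm (n := ∞) (x := p))
  refine (h1.comp h2 fun y hy => e.map_target hy).congr fun y hy => ?_
  have h3 : mfderivWithin 𝓘(ℝ, E) 𝓘(ℝ, E) e e.source (e.symm y) =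
      mfderiv 𝓘(ℝ, E) 𝓘(ℝ, E) e (e.symm y) :=
    mfderivWithin_of_isOpen e.open_source (e.map_target hy)
  refine Bundle.TotalSpace.ext (e.right_inv hy).symm ?_
  simp only [Function.comp_apply, tangentMapWithin, h3]
  rfl

lemma hasMFDerivAt_symm_comp (p : M) {c : ℝ → E} {t : ℝ} {v : TangentSpace 𝓘(ℝ, E)
      ((chartAt E p).symm (c t))}
    (hx : c t ∈ (chartAt E p).target)
    (h : HasDerivAt c (chartVel p ((chartAt E p).symm (c t)) v) t) :
    HasMFDerivAt 𝓘(ℝ, ℝ) 𝓘(ℝ, E) (fun s => (chartAt E p).symm (c s)) t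
      ((1 : ℝ →L[ℝ] ℝ).smulRight v) := by
  have h1 := ((mdifferentiable_chart (I := 𝓘(ℝ, E)) p).mdifferentiableAt_symm hx).hasMFDerivAt.comp t
    (hasMFDerivAt_iff_hasFDerivAt.2 h.hasFDerivAt)
  have h2 := (mdifferentiable_chart (I := 𝓘(ℝ, E)) p).symm_comp_deriv
    ((chartAt E p).map_target hx)
  rw [(chartAt E p).right_inv hx] at h2
  refine h1.congr_mfderiv (ContinuousLinearMap.ext fun (a : ℝ) => ?_)
  have h3 := congrArg (fun T => a • T v) h2
  refine Eq.trans ?_ h3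
  exact map_smul (mfderiv 𝓘(ℝ, E) 𝓘(ℝ, E) (chartAt E p).symm (c t)) a _

lemma hasDerivAt_chart_comp (p : M) {γ : ℝ → M} {t : ℝ} {v : TangentSpace 𝓘(ℝ, E) (γ t)}
    (hx : γ t ∈ (chartAt E p).source)
    (h : HasMFDerivAt 𝓘(ℝ, ℝ) 𝓘(ℝ, E) γ t ((1 : ℝ →L[ℝ] ℝ).smulRight v)) :
    HasDerivAt (fun s => chartAt E p (γ s)) (chartVel p (γ t) v) t := by
  have h1 := ((mdifferentiable_chart (I := 𝓘(ℝ, E)) p).mdifferentiableAt hx).hasMFDerivAt.comp t h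
  have h2 : HasFDerivAt (fun s => chartAt E p (γ s))
      (((1 : ℝ →L[ℝ] ℝ).smulRight (chartVel p (γ t) v : E)) : ℝ →L[ℝ] E) t := by
    refine (hasMFDerivAt_iff_hasFDerivAt.1 h1).congr_fderiv
      (ContinuousLinearMap.ext fun (a : ℝ) => ?_)
    exact map_smul (chartVel p (γ t)) a v
  simpa using h2.hasDerivAt

end Charts

/-! ### Comparison of length and distance with functions -/

lemma LipschitzOnWith.comp_absolutelyContinuousOnInterval {Y W : Type*} [PseudoMetricSpace Y]
    [PseudoMetricSpace W] {g : Y → W} {c : ℝ → Y} {a b : ℝ} {K : NNReal}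
    (hg : LipschitzOnWith K g (c '' uIcc a b)) (hc : AbsolutelyContinuousOnInterval c a b) :
    AbsolutelyContinuousOnInterval (fun t => g (c t)) a b := by
  rw [absolutelyContinuousOnInterval_iff] at hc ⊢
  intro ε hε
  -- `K + 1` rather than `K`, since `K` may be zero.
  obtain ⟨δ, hδ, h⟩ := hc (ε / (K + 1)) (by positivity)
  refine ⟨δ, hδ, fun I hI hlt => ?_⟩
  calc ∑ i ∈ Finset.range I.1, dist (g (c (I.2 i).1)) (g (c (I.2 i).2))
      ≤ ∑ i ∈ Finset.range I.1, K * dist (c (I.2 i).1) (c (I.2 i).2) :=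
        Finset.sum_le_sum fun i hi => hg.dist_le_mul _ (mem_image_of_mem _ (hI.left i hi).left) _
          (mem_image_of_mem _ (hI.left i hi).right)
    _ = K * ∑ i ∈ Finset.range I.1, dist (c (I.2 i).1) (c (I.2 i).2) := by rw [Finset.mul_sum]
    _ ≤ K * (ε / (K + 1)) := by
        gcongr
        exact (h I hI hlt).le
    _ < (K + 1) * (ε / (K + 1)) := by gcongr; linarith
    _ = ε := by field_simp

section Comparison

variable {E : Type*} [NormedAddCommGroup E] [NormedSpace ℝ E]
variable {M : Type*} [TopologicalSpace M] [ChartedSpace E M]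
variable {ι : Type*} [Fintype ι] {X : ι → (x : M) → TangentSpace 𝓘(ℝ, E) x}

/-- Curves have positive duration by definition, so the constant curve on `[0, 1]` is used. This
covers points with `φ = 0`. -/
lemma frameEDist_self (x : M) : frameEDist X x x = 0 := by
  refine le_antisymm ?_ zero_le
  have hd : ∀ t : ℝ, HasMFDerivAt 𝓘(ℝ, ℝ) 𝓘(ℝ, E) (fun _ : ℝ => x) t
      ((1 : ℝ →L[ℝ] ℝ).smulRight (∑ i, (0 : ℝ) • X i x)) := by
    intro t
    refine (hasMFDerivAt_const x t).congr_mfderiv (ContinuousLinearMap.ext fun (a : ℝ) => ?_)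
    simp
    rfl
  have hcurve : IsHorizontalCurve X 1 (fun _ : ℝ => x) := by
    refine ⟨⟨continuousOn_const, fun x₀ a b _ _ _ _ => ?_⟩, fun _ _ => 0, fun i => ?_, ?_⟩
    · exact (LipschitzWith.const _).lipschitzOnWith.absolutelyContinuousOnInterval
    · simp
    · exact Eventually.of_forall hd
  have hlen : curveLength X 1 (fun _ : ℝ => x) = 0 := by
    have h1 : ∀ t : ℝ, ENNReal.ofReal
        (frameNorm X x (mfderiv 𝓘(ℝ, ℝ) 𝓘(ℝ, E) (fun _ : ℝ => x) t (1 : ℝ))) = 0 := by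
      intro t
      have h2 : mfderiv 𝓘(ℝ, ℝ) 𝓘(ℝ, E) (fun _ : ℝ => x) t (1 : ℝ) = ∑ i, (0 : ℝ) • X i x := by
        rw [(hd t).mfderiv]
        exact one_smul ℝ _
      rw [h2, ENNReal.ofReal_eq_zero]
      exact (frameNorm_le X x fun _ => 0).trans (by simp)
    simp only [curveLength, h1, lintegral_zero]
  rw [← hlen]
  exact iInf_le_of_le 1 (iInf_le_of_le _ (iInf_le_of_le one_pos (iInf_le_of_le hcurve
    (iInf_le_of_le rfl (iInf_le_of_le rfl le_rfl)))))

variable [IsManifold 𝓘(ℝ, E) ∞ M]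

/-- The calibration inequality. On the compact image of the curve `g` is Lipschitz, so `g ∘ γ` is
absolutely continuous and is the integral of its derivative, which `abs_le_frameNorm` bounds by `C`
times the speed. -/
lemma IsHorizontalCurve.ofReal_abs_sub_le {T : ℝ} {γ : ℝ → M} (hγ : IsHorizontalCurve X T γ)
    (p : M) {g : E → ℝ} {B : Set E} (hB : IsOpen B) (hg : ContDiffOn ℝ 1 g B) {C : ℝ} (hC : 0 < C)
    (hbound : ∀ y ∈ B, ∑ i, fderiv ℝ g y (coordField p (X i) y) ^ 2 ≤ C ^ 2) {a b : ℝ}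
    (ha : 0 ≤ a) (hab : a ≤ b) (hb : b ≤ T)
    (hmaps : ∀ t ∈ Icc a b, γ t ∈ (chartAt E p).source ∧ chartAt E p (γ t) ∈ B) :
    ENNReal.ofReal |g (chartAt E p (γ b)) - g (chartAt E p (γ a))| ≤
      ENNReal.ofReal C * curveLength X T γ := by
  set c : ℝ → E := fun t => chartAt E p (γ t) with hc
  have hAC : AbsolutelyContinuousOnInterval c a b :=
    hγ.absolutelyContinuous.2 p a b ha hab hb fun t ht => (hmaps t ht).1
  have hcB : c '' uIcc a b ⊆ B := by
    rw [uIcc_of_le hab]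
    rintro _ ⟨t, ht, rfl⟩
    exact (hmaps t ht).2
  have hloc : LocallyLipschitzOn (c '' uIcc a b) g := by
    intro y hy
    obtain ⟨K, t, ht, hK⟩ := (hg.contDiffAt (hB.mem_nhds (hcB hy))).exists_lipschitzOnWith
    exact ⟨K, t, mem_nhdsWithin_of_mem_nhds ht, hK⟩
  obtain ⟨K, hK⟩ := hloc.exists_lipschitzOnWith_of_compact
    (isCompact_uIcc.image_of_continuousOn hAC.continuousOn)
  have hACg := LipschitzOnWith.comp_absolutelyContinuousOnInterval hK hAC
  obtain ⟨u, -, hu⟩ := hγ.exists_control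
  have hsub : Ioc a b ⊆ Icc 0 T := fun t ht => ⟨ha.trans ht.1.le, ht.2.trans hb⟩
  have hae : ∀ᵐ t ∂(volume.restrict (Ioc a b)), ‖deriv (fun t => g (c t)) t‖ₑ ≤
      ENNReal.ofReal C * ENNReal.ofReal
        (frameNorm X (γ t) (mfderiv 𝓘(ℝ, ℝ) 𝓘(ℝ, E) γ t (1 : ℝ))) := by
    filter_upwards [ae_restrict_of_ae_restrict_of_subset hsub hu,
      ae_restrict_mem measurableSet_Ioc] with t ht htm
    have hm := hmaps t (Ioc_subset_Icc_self htm)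
    have h1 := hasDerivAt_chart_comp p hm.1 ht
    have h2 : HasDerivAt (fun t => g (c t)) _ t :=
      ((hg.contDiffAt (hB.mem_nhds hm.2)).differentiableAt (by simp)).hasFDerivAt.comp_hasDerivAt
        t h1
    have h3 : (mfderiv 𝓘(ℝ, ℝ) 𝓘(ℝ, E) γ t (1 : ℝ)) = ∑ i, u t i • X i (γ t) := by
      rw [ht.mfderiv]
      exact one_smul ℝ _
    have h4 := abs_le_frameNorm (X := X) (x := γ t)
      ((fderiv ℝ g (c t)).comp (chartVel p (γ t))).toLinearMap hC (by
        have := hbound _ hm.2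
        simp_rw [coordField_chartAt p _ hm.1] at this
        exact this) (u t)
    rw [h2.deriv, h3, ← ENNReal.ofReal_mul hC.le, ← ofReal_norm, Real.norm_eq_abs]
    exact ENNReal.ofReal_le_ofReal h4
  have hFTC := hACg.integral_deriv_eq_sub
  rw [intervalIntegral.integral_of_le hab] at hFTC
  calc ENNReal.ofReal |g (c b) - g (c a)|
      = ‖∫ t in Ioc a b, deriv (fun t => g (c t)) t‖ₑ := by
        rw [hFTC, ← ofReal_norm, Real.norm_eq_abs]
    _ ≤ ∫⁻ t in Ioc a b, ‖deriv (fun t => g (c t)) t‖ₑ := enorm_integral_le_lintegral_enorm _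
    _ ≤ ∫⁻ t in Ioc a b, ENNReal.ofReal C * ENNReal.ofReal
        (frameNorm X (γ t) (mfderiv 𝓘(ℝ, ℝ) 𝓘(ℝ, E) γ t (1 : ℝ))) := lintegral_mono_ae hae
    _ ≤ ∫⁻ t in Icc 0 T, ENNReal.ofReal C * ENNReal.ofReal
        (frameNorm X (γ t) (mfderiv 𝓘(ℝ, ℝ) 𝓘(ℝ, E) γ t (1 : ℝ))) := lintegral_mono_set hsub
    _ = ENNReal.ofReal C * curveLength X T γ :=
        lintegral_const_mul' _ _ ENNReal.ofReal_ne_top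

/-- A curve that stays in the half ball is calibrated by `g`. One that does not must let `χ` climb
from `0` to `1` after its last time outside, so its length is at least `1 / C`, which is at least
`g` at the endpoint. -/
lemma ofReal_le_edistFrom [FiniteDimensional ℝ E] [T2Space M] {S : Set M} (p : M) {R : ℝ}
    (hR : 0 < R) (hBt : Metric.ball (chartAt E p p) R ⊆ (chartAt E p).target) {g χ : E → ℝ}
    (hg : ContDiffOn ℝ 1 g (Metric.ball (chartAt E p p) R))
    (hgX : ∀ y ∈ Metric.ball (chartAt E p p) R,
      ∑ i, fderiv ℝ g y (coordField p (X i) y) ^ 2 ≤ 1)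
    (hχ : ContDiffOn ℝ 1 χ (Metric.ball (chartAt E p p) R)) {C : ℝ} (hC : 0 < C)
    (hχX : ∀ y ∈ Metric.ball (chartAt E p p) R,
      ∑ i, fderiv ℝ χ y (coordField p (X i) y) ^ 2 ≤ C ^ 2)
    (hχ0 : ∀ y ∉ Metric.ball (chartAt E p p) (R / 2), χ y = 0)
    (hS : ∀ z ∈ S, z ∈ (chartAt E p).source → chartAt E p z ∈ Metric.ball (chartAt E p p) R →
      g (chartAt E p z) = 0)
    {x : M} (hx : x ∈ (chartAt E p).source)
    (hxR : chartAt E p x ∈ Metric.ball (chartAt E p p) (R / 2)) (hχx : χ (chartAt E p x) = 1)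
    (hgx : C * g (chartAt E p x) ≤ 1) :
    ENNReal.ofReal (g (chartAt E p x)) ≤ edistFrom X S x := by
  set e := chartAt E p
  have : ProperSpace E := FiniteDimensional.proper ℝ E
  refine le_iInf₂ fun z hz => le_iInf fun T => le_iInf fun γ => le_iInf fun hT => le_iInf fun hγ =>
    le_iInf fun h0 => le_iInf fun h1 => ?_
  set O : Set M := e.source ∩ e ⁻¹' Metric.ball (e p) (R / 2) with hO
  have hOo : IsOpen O := e.isOpen_inter_preimage Metric.isOpen_ball
  have hhalf : Metric.closedBall (e p) (R / 2) ⊆ Metric.ball (e p) R :=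
    Metric.closedBall_subset_ball (by linarith)
  have hγc : ContinuousOn γ (Icc 0 T) := hγ.absolutelyContinuous.1
  by_cases hall : ∀ t ∈ Icc 0 T, γ t ∈ O
  · have h2 := hγ.ofReal_abs_sub_le p Metric.isOpen_ball hg one_pos
      (fun y hy => by simpa using hgX y hy) le_rfl hT.le le_rfl
      (fun t ht => ⟨(hall t ht).1, hhalf (Metric.ball_subset_closedBall (hall t ht).2)⟩)
    have h3 := hall 0 ⟨le_rfl, hT.le⟩
    rw [h0] at h3
    rw [h0, h1, hS z hz h3.1 (hhalf (Metric.ball_subset_closedBall h3.2)), sub_zero,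
      ENNReal.ofReal_one, one_mul] at h2
    exact (ENNReal.ofReal_le_ofReal (le_abs_self _)).trans h2
  · push Not at hall
    set S' : Set ℝ := Icc 0 T ∩ γ ⁻¹' Oᶜ with hS'
    have hS'c : IsCompact S' := isCompact_Icc.of_isClosed_subset
      (hγc.preimage_isClosed_of_isClosed isClosed_Icc hOo.isClosed_compl) inter_subset_left
    have hS'n : S'.Nonempty := hall
    -- The last time outside the half ball; afterwards the curve remains in the chart until it
    -- reaches `x`.
    set t₀ := sSup S' with ht₀
    have hmem : t₀ ∈ S' := hS'c.sSup_mem hS'n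
    have hafter : ∀ t ∈ Ioc t₀ T, γ t ∈ O := by
      intro t ht
      by_contra hcon
      exact absurd (le_csSup hS'c.bddAbove (show t ∈ S' from ⟨⟨hmem.1.1.trans ht.1.le, ht.2⟩, hcon⟩))
        (not_le.2 ht.1)
    have hlt : t₀ < T := by
      refine lt_of_le_of_ne hmem.1.2 fun heq => hmem.2 ?_
      rw [heq, h1]
      exact ⟨hx, hxR⟩
    -- At `t₀` the curve might a priori lie outside the chart domain. It is a limit of points of
    -- this compact, hence closed, set, which rules that out.
    have hK : IsClosed (e.symm '' Metric.closedBall (e p) (R / 2)) :=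
      ((isCompact_closedBall _ _).image_of_continuousOn
        (e.continuousOn_symm.mono (hhalf.trans hBt))).isClosed
    have hγt₀ : γ t₀ ∈ e.symm '' Metric.closedBall (e p) (R / 2) := by
      have h2 : ContinuousWithinAt γ (Ioc t₀ T) t₀ :=
        (hγc t₀ hmem.1).mono fun t ht => ⟨hmem.1.1.trans ht.1.le, ht.2⟩
      have h3 : t₀ ∈ closure (Ioc t₀ T) := by
        rw [closure_Ioc hlt.ne]
        exact ⟨le_rfl, hlt.le⟩
      have h4 := h2.mem_closure h3 (t := e.symm '' Metric.closedBall (e p) (R / 2)) fun t ht =>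
        ⟨e (γ t), Metric.ball_subset_closedBall (hafter t ht).2, e.left_inv (hafter t ht).1⟩
      rwa [hK.closure_eq] at h4
    obtain ⟨y, hy, hyγ⟩ := hγt₀
    have hyt := hBt (hhalf hy)
    have hsrc : γ t₀ ∈ e.source := by
      rw [← hyγ]
      exact e.map_target hyt
    have hey : e (γ t₀) = y := by rw [← hyγ, e.right_inv hyt]
    have hχ₀ : χ (e (γ t₀)) = 0 := hχ0 _ fun hcon => hmem.2 ⟨hsrc, hcon⟩
    have h2 := hγ.ofReal_abs_sub_le p Metric.isOpen_ball hχ hC hχX hmem.1.1 hlt.le le_rfl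
      (fun t ht => by
        rcases eq_or_lt_of_le ht.1 with rfl | hlt'
        · exact ⟨hsrc, by rw [hey]; exact hhalf hy⟩
        · have := hafter t ⟨hlt', ht.2⟩
          exact ⟨this.1, hhalf (Metric.ball_subset_closedBall this.2)⟩)
    rw [h1, hχ₀, hχx, sub_zero, abs_one, ENNReal.ofReal_one] at h2
    have h3 : ENNReal.ofReal C * ENNReal.ofReal (g (e x)) ≤
        ENNReal.ofReal C * curveLength X T γ := by
      rw [← ENNReal.ofReal_mul hC.le]
      refine le_trans ?_ h2
      rw [← ENNReal.ofReal_one]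
      exact ENNReal.ofReal_le_ofReal hgx
    exact (ENNReal.mul_le_mul_iff_right (ENNReal.ofReal_pos.2 hC).ne' ENNReal.ofReal_ne_top).1 h3

/-- Only an upper bound is claimed: the frame norm is an infimum over controls, so a unit control
gives speed at most `1`. -/
lemma frameEDist_le_of_chart_curve (p : M) {s : ℝ} (hs : 0 ≤ s) {c : ℝ → E} {u : ℝ → ι → ℝ}
    (hct : ∀ t ∈ Icc 0 s, c t ∈ (chartAt E p).target) (hc : ContDiffOn ℝ ∞ c (Icc 0 s))
    (hu : ContinuousOn u (Icc 0 s))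
    (hd : ∀ t ∈ Icc 0 s, HasDerivAt c (∑ i, u t i • coordField p (X i) (c t)) t)
    (hsq : ∀ t ∈ Icc 0 s, ∑ i, u t i ^ 2 = 1) :
    frameEDist X ((chartAt E p).symm (c 0)) ((chartAt E p).symm (c s)) ≤ ENNReal.ofReal s := by
  rcases hs.eq_or_lt with rfl | hpos
  · rw [frameEDist_self]
    exact zero_le
  set e := chartAt E p
  set γ : ℝ → M := fun t => e.symm (c t) with hγ
  have hd' : ∀ t ∈ Icc 0 s, HasMFDerivAt 𝓘(ℝ, ℝ) 𝓘(ℝ, E) γ t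
      ((1 : ℝ →L[ℝ] ℝ).smulRight (∑ i, u t i • X i (γ t))) := by
    intro t ht
    refine hasMFDerivAt_symm_comp p (hct t ht) ?_
    convert! hd t ht using 1
    rw [map_sum]
    exact Finset.sum_congr rfl fun i _ => map_smul _ _ _
  have hγs : ContMDiffOn 𝓘(ℝ, ℝ) 𝓘(ℝ, E) ∞ γ (Icc 0 s) :=
    (contMDiffOn_chart_symm (n := ∞) (x := p)).comp hc.contMDiffOn hct
  have hcurve : IsHorizontalCurve X s γ := by
    refine ⟨⟨hγs.continuousOn, fun x₀ a b ha hab hb hmaps => ?_⟩, u, fun i => ?_, ?_⟩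
    · have h1 : ContMDiffOn 𝓘(ℝ, ℝ) 𝓘(ℝ, E) ∞ (fun t => chartAt E x₀ (γ t)) (Icc a b) :=
        (contMDiffOn_chart (n := ∞) (x := x₀)).comp (hγs.mono (Icc_subset_Icc ha hb)) hmaps
      refine ContDiffOn.absolutelyContinuousOnInterval ?_
      rw [uIcc_of_le hab]
      exact h1.contDiffOn.of_le (by simp)
    · have hui : ContinuousOn (fun t => u t i) (Icc 0 s) := (continuous_apply i).comp_continuousOn hu
      refine MemLp.of_bound (hui.aestronglyMeasurable measurableSet_Icc) 1 ?_
      filter_upwards [ae_restrict_mem measurableSet_Icc] with t ht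
      rw [Real.norm_eq_abs, abs_le_one_iff_mul_self_le_one, ← sq, ← hsq t ht]
      exact Finset.single_le_sum (f := fun i => u t i ^ 2) (fun i _ => sq_nonneg _)
        (Finset.mem_univ i)
    · filter_upwards [ae_restrict_mem measurableSet_Icc] with t ht using hd' t ht
  have hlen : curveLength X s γ ≤ ENNReal.ofReal s := by
    calc curveLength X s γ ≤ ∫⁻ _ in Icc 0 s, 1 := by
          refine lintegral_mono_ae ?_
          filter_upwards [ae_restrict_mem measurableSet_Icc] with t ht
          have h2 : mfderiv 𝓘(ℝ, ℝ) 𝓘(ℝ, E) γ t (1 : ℝ) = ∑ i, u t i • X i (γ t) := by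
            rw [(hd' t ht).mfderiv]
            exact one_smul ℝ _
          rw [h2, ENNReal.ofReal_le_one]
          exact (frameNorm_le X _ (u t)).trans (by rw [hsq t ht, Real.sqrt_one])
      _ = ENNReal.ofReal s := by simp
  refine le_trans ?_ hlen
  exact iInf_le_of_le s (iInf_le_of_le γ (iInf_le_of_le hpos (iInf_le_of_le hcurve
    (iInf_le_of_le rfl (iInf_le_of_le rfl le_rfl)))))

end Comparison

/-! ### The distance from the boundary near a boundary point -/

/-- Multiplying by a bump function replaces local data by globally smooth data with the same germ,
as the flow theorem requires. -/
lemma exists_contDiff_eventuallyEq {E F : Type*} [NormedAddCommGroup E] [NormedSpace ℝ E]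
    [FiniteDimensional ℝ E] [NormedAddCommGroup F] [NormedSpace ℝ F] {O : Set E} (hO : IsOpen O)
    {g : E → F} (hg : ContDiffOn ℝ ∞ g O) {a : E} (ha : a ∈ O) :
    ∃ g' : E → F, ContDiff ℝ ∞ g' ∧ g' =ᶠ[𝓝 a] g := by
  obtain ⟨r, hr, hball⟩ := Metric.nhds_basis_closedBall.mem_iff.1 (hO.mem_nhds ha)
  let χ : ContDiffBump a := ⟨r / 2, r, by positivity, by linarith⟩
  refine ⟨fun y => χ y • g y, ?_, ?_⟩
  · refine contDiff_iff_contDiffAt.2 fun y => ?_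
    by_cases hy : y ∈ O
    · exact χ.contDiff.contDiffAt.smul (hg.contDiffAt (hO.mem_nhds hy))
    · have hyt : y ∉ tsupport χ := by
        rw [χ.tsupport_eq]
        exact fun h => hy (hball h)
      refine (contDiffAt_const (c := (0 : F))).congr_of_eventuallyEq ?_
      filter_upwards [(isClosed_tsupport χ).isOpen_compl.mem_nhds hyt] with z hz
      rw [image_eq_zero_of_notMem_tsupport hz, zero_smul]
  · filter_upwards [χ.eventuallyEq_one] with y hy
    rw [hy, Pi.one_apply, one_smul]

section Boundary

variable {E : Type*} [NormedAddCommGroup E] [NormedSpace ℝ E]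
variable {M : Type*} [TopologicalSpace M] [ChartedSpace E M]
variable {Ω : Set M} {p : M} {V : Set M} {f : M → ℝ}

lemma IsLocalDefiningFunction.mem_iff (h : IsLocalDefiningFunction E Ω p V f) {z : M}
    (hz : z ∈ V) : z ∈ Ω ↔ f z < 0 := by
  have := Set.ext_iff.1 h.eq_sublevel z
  simpa [hz] using this

lemma IsLocalDefiningFunction.nonpos (h : IsLocalDefiningFunction E Ω p V f) {z : M}
    (hz : z ∈ V) (hzΩ : z ∈ closure Ω) : f z ≤ 0 := by
  by_contra hpos
  have hopen : IsOpen (V ∩ f ⁻¹' Ioi 0) := h.smooth.continuousOn.isOpen_inter_preimage h.isOpen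
    isOpen_Ioi
  obtain ⟨w, hw, hwΩ⟩ := mem_closure_iff.1 hzΩ _ hopen ⟨hz, not_le.1 hpos⟩
  exact lt_asymm ((h.mem_iff hw.1).1 hwΩ) hw.2

lemma IsLocalDefiningFunction.eq_zero (h : IsLocalDefiningFunction E Ω p V f) (hΩ : IsOpen Ω)
    {z : M} (hz : z ∈ V) (hzΩ : z ∈ frontier Ω) : f z = 0 := by
  rw [hΩ.frontier_eq] at hzΩ
  exact le_antisymm (h.nonpos hz hzΩ.1) (not_lt.1 fun hlt => hzΩ.2 ((h.mem_iff hz).2 hlt))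

lemma IsLocalDefiningFunction.mem_frontier (h : IsLocalDefiningFunction E Ω p V f)
    (hΩ : IsOpen Ω) {z : M} (hz : z ∈ V) (hfz : f z = 0) (hzΩ : z ∈ closure Ω) :
    z ∈ frontier Ω := by
  rw [hΩ.frontier_eq]
  exact ⟨hzΩ, fun hcon => ((h.mem_iff hz).1 hcon).ne hfz⟩

lemma fderiv_comp_symm_chartVel [IsManifold 𝓘(ℝ, E) ∞ M] {x : M}
    (hf : ContMDiffOn 𝓘(ℝ, E) 𝓘(ℝ, ℝ) ∞ f V)
    (hV : IsOpen V) (hxV : x ∈ V) (hx : x ∈ (chartAt E p).source)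
    (v : TangentSpace 𝓘(ℝ, E) x) :
    fderiv ℝ (f ∘ (chartAt E p).symm) (chartAt E p x) (chartVel p x v) =
      mfderiv 𝓘(ℝ, E) 𝓘(ℝ, ℝ) f x v := by
  set e := chartAt E p
  have hO : IsOpen (e.target ∩ e.symm ⁻¹' V) := e.isOpen_inter_preimage_symm hV
  have hmem : e x ∈ e.target ∩ e.symm ⁻¹' V :=
    ⟨e.map_source hx, by rw [mem_preimage, e.left_inv hx]; exact hxV⟩
  have h1 : ContMDiffOn 𝓘(ℝ, E) 𝓘(ℝ, ℝ) ∞ (f ∘ e.symm) (e.target ∩ e.symm ⁻¹' V) :=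
    hf.comp ((contMDiffOn_chart_symm (n := ∞) (x := p)).mono inter_subset_left) fun y hy => hy.2
  have h2 : HasMFDerivAt 𝓘(ℝ, E) 𝓘(ℝ, ℝ) (f ∘ e.symm) (e x) (fderiv ℝ (f ∘ e.symm) (e x)) :=
    hasMFDerivAt_iff_hasFDerivAt.2
      ((h1.contDiffOn.contDiffAt (hO.mem_nhds hmem)).differentiableAt (by simp)).hasFDerivAt
  have h3 := h2.comp x ((mdifferentiable_chart (I := 𝓘(ℝ, E)) p).mdifferentiableAt hx).hasMFDerivAt
  have h4 : f =ᶠ[𝓝 x] (f ∘ e.symm) ∘ e := by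
    filter_upwards [e.open_source.mem_nhds hx] with y hy
    simp [e.left_inv hy]
  rw [(h3.congr_of_eventuallyEq h4).mfderiv]
  rfl

end Boundary

section LocalDistance

variable {E : Type*} [NormedAddCommGroup E] [NormedSpace ℝ E] [FiniteDimensional ℝ E]
variable {M : Type*} [TopologicalSpace M] [T2Space M] [ChartedSpace E M]
  [IsManifold 𝓘(ℝ, E) ∞ M]
variable {ι κ : Type*} [Fintype ι] [Fintype κ]

/-- The eikonal solution in the chart is at least the distance, by its characteristic, and at most
the distance, by calibration. The radius `r` serves all `ε` near `ε₀`, including across `ε = 0`. -/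
theorem exists_local_distance {X : ι → (x : M) → TangentSpace 𝓘(ℝ, E) x}
    (hX : ∀ i, IsSmoothField (X i)) {Y : κ → (x : M) → TangentSpace 𝓘(ℝ, E) x}
    (hY : ∀ j, IsSmoothField (Y j)) {Ω : Set M} (hΩ : IsOpen Ω) (hbd : HasSmoothBoundary E Ω)
    {p : M} (hp : p ∈ frontier Ω) (hchar : ¬ IsCharacteristicPoint X Ω p) (ε₀ : ℝ) :
    ∃ r > 0, ∃ φ : ℝ × E → ℝ,
      Metric.ball (chartAt E p p) r ⊆ (chartAt E p).target ∧
      ContDiffOn ℝ ∞ φ (Metric.ball (ε₀, chartAt E p p) r) ∧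
      ∀ ε x, |ε - ε₀| < r → x ∈ (chartAt E p).source →
        chartAt E p x ∈ Metric.ball (chartAt E p p) r → x ∈ closure Ω →
        0 ≤ φ (ε, chartAt E p x) ∧ edistFrom (variationFrame X Y ε) (frontier Ω) x =
          ENNReal.ofReal (φ (ε, chartAt E p x)) := by
  have : CompleteSpace E := FiniteDimensional.complete ℝ E
  have : ProperSpace E := FiniteDimensional.proper ℝ E
  obtain ⟨V, f, hdef⟩ := hbd p hp
  set e := chartAt E p with he
  have hpe : p ∈ e.source := mem_chart_source E p
  set y₀ := e p with hy₀
  have hy₀t : y₀ ∈ e.target := e.map_source hpe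
  have hOf : IsOpen (e.target ∩ e.symm ⁻¹' V) := e.isOpen_inter_preimage_symm hdef.isOpen
  have hy₀V : y₀ ∈ e.target ∩ e.symm ⁻¹' V :=
    ⟨hy₀t, by rw [mem_preimage, e.left_inv hpe]; exact hdef.mem⟩
  have hfs : ContDiffOn ℝ ∞ (f ∘ e.symm) (e.target ∩ e.symm ⁻¹' V) :=
    (hdef.smooth.comp ((contMDiffOn_chart_symm (n := ∞) (x := p)).mono inter_subset_left)
      fun y hy => hy.2).contDiffOn
  obtain ⟨F, hF, hFf⟩ := exists_contDiff_eventuallyEq hOf hfs hy₀V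
  choose X' hX' hXX' using fun i =>
    exists_contDiff_eventuallyEq e.open_target (contDiffOn_coordField p (hX i)) hy₀t
  choose Y' hY' hYY' using fun j =>
    exists_contDiff_eventuallyEq e.open_target (contDiffOn_coordField p (hY j)) hy₀t
  set Z : ι ⊕ κ → ℝ × E → E := Sum.elim (fun i a => X' i a.2) (fun j a => a.1 • Y' j a.2) with hZdef
  have hZ : ∀ k, ContDiff ℝ ∞ (Z k) := by
    rintro (i | j)
    · exact (hX' i).comp contDiff_snd
    · exact contDiff_fst.smul ((hY' j).comp contDiff_snd)
  have hFp : F y₀ = 0 := by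
    rw [hFf.self_of_nhds, Function.comp_apply, e.left_inv hpe, hdef.eq_zero hΩ hdef.mem hp]
  -- Noncharacteristicity provides some `X i` transverse to the boundary, which makes the sum
  -- positive whatever `ε₀` is.
  have hgrad : 0 < gradSq Z F (ε₀, y₀) := by
    obtain ⟨i, hi⟩ : ∃ i, mfderiv 𝓘(ℝ, E) 𝓘(ℝ, ℝ) f p (X i p) ≠ 0 := by
      by_contra! hcon
      refine hchar ⟨hp, V, f, hdef, fun v hv => ?_⟩
      have hle : distribution X p ≤ (mfderiv 𝓘(ℝ, E) 𝓘(ℝ, ℝ) f p).ker := by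
        refine Submodule.span_le.2 ?_
        rintro _ ⟨i, rfl⟩
        exact hcon i
      exact hle hv
    have h1 : fderiv ℝ F y₀ (Z (Sum.inl i) (ε₀, y₀)) ≠ 0 := by
      have h2 : Z (Sum.inl i) (ε₀, y₀) = chartVel p p (X i p) := by
        simp only [hZdef, Sum.elim_inl]
        rw [(hXX' i).self_of_nhds, hy₀, he, coordField_chartAt p _ hpe]
      rw [hFf.fderiv_eq, h2, hy₀, he,
        fderiv_comp_symm_chartVel hdef.smooth hdef.isOpen hdef.mem hpe]
      exact hi
    exact Finset.sum_pos' (fun k _ => sq_nonneg _)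
      ⟨Sum.inl i, Finset.mem_univ _, by positivity⟩
  have hgood : ∀ᶠ y in 𝓝 y₀, (y ∈ e.target ∧ e.symm y ∈ V) ∧ F y = f (e.symm y) ∧
      (∀ i, X' i y = coordField p (X i) y) ∧ ∀ j, Y' j y = coordField p (Y j) y :=
    (show ∀ᶠ y in 𝓝 y₀, y ∈ e.target ∧ e.symm y ∈ V from hOf.mem_nhds hy₀V).and
      (hFf.and ((eventually_all.2 hXX').and (eventually_all.2 hYY')))
  obtain ⟨R₀, hR₀, hR₀sub⟩ := Metric.mem_nhds_iff.1 hgood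
  have hZcoord : ∀ y ∈ Metric.ball y₀ R₀, ∀ ε k,
      Z k (ε, y) = coordField p (variationFrame X Y ε k) y := by
    rintro y hy ε (i | j)
    · exact (hR₀sub hy).2.2.1 i
    · simp only [hZdef, Sum.elim_inr, variationFrame]
      rw [(hR₀sub hy).2.2.2 j]
      exact (map_smul (chartVel p (e.symm y)) ε _).symm
  obtain ⟨W, φ, hWo, hW₀, hφ, hsol⟩ := exists_local_eikonal hZ hF hFp hgrad
    (Metric.ball_mem_nhds y₀ hR₀)
  obtain ⟨R₁, hR₁, hR₁sub⟩ := Metric.isOpen_iff.1 hWo _ hW₀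
  set R := min 1 (min R₀ R₁) with hRdef
  have hR : 0 < R := lt_min one_pos (lt_min hR₀ hR₁)
  have hRR₀ : Metric.ball y₀ R ⊆ Metric.ball y₀ R₀ :=
    Metric.ball_subset_ball ((min_le_right _ _).trans (min_le_left _ _))
  have hRW : ∀ ε y, |ε - ε₀| < R → y ∈ Metric.ball y₀ R → (ε, y) ∈ W := by
    intro ε y hε hy
    refine hR₁sub ?_
    have hle : R ≤ R₁ := (min_le_right _ _).trans (min_le_right _ _)
    rw [← ball_prod_same]
    exact ⟨(by simpa [Real.dist_eq] using hε.trans_le hle), Metric.ball_subset_ball hle hy⟩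
  -- The cutoff that penalises escape: `1` on the ball containing the final points, `0` outside the
  -- half ball. Its horizontal gradient is bounded on a compact set of `(ε, y)`, so one `C` serves
  -- all nearby parameters.
  let χ : ContDiffBump y₀ := ⟨R / 4, R / 2, by positivity, by linarith⟩
  have hχ : ContDiff ℝ ∞ χ := χ.contDiff
  obtain ⟨C₀, hC₀⟩ := (isCompact_closedBall (ε₀, y₀) R).exists_bound_of_continuousOn
    (contDiff_gradSq hZ hχ).continuous.continuousOn
  -- Chosen so that `|C₀| ≤ C ^ 2`.
  set C := |C₀| + 1 with hCdef
  have hC : 0 < C := by positivity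
  have hφ₀ : φ (ε₀, y₀) = 0 := (hsol _ _ hW₀).2.1 hFp
  -- As `φ` vanishes at the base point, close to it leaving the ball costs more than `φ`.
  have hsmall : ∀ᶠ a in 𝓝 (ε₀, y₀), C * φ a < 1 := by
    have h1 : ContinuousAt (fun a => C * φ a) (ε₀, y₀) :=
      continuousAt_const.mul (hφ.continuousOn.continuousAt (hWo.mem_nhds hW₀))
    refine h1.eventually_lt_const ?_
    simp only [hφ₀, mul_zero]
    exact one_pos
  obtain ⟨R₂, hR₂, hR₂sub⟩ := Metric.mem_nhds_iff.1 hsmall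
  set r := min (R / 4) R₂ with hrdef
  have hr : 0 < r := lt_min (by positivity) hR₂
  have hrR : r ≤ R / 4 := min_le_left _ _
  have hballR : Metric.ball y₀ r ⊆ Metric.ball y₀ R := Metric.ball_subset_ball (by linarith)
  refine ⟨r, hr, φ, fun y hy => (hR₀sub (hRR₀ (hballR hy))).1.1, hφ.mono ?_, ?_⟩
  · rintro ⟨ε, y⟩ hεy
    rw [← ball_prod_same] at hεy
    have h1 : |ε - ε₀| < r := by simpa [Real.dist_eq] using hεy.1
    exact hRW ε y (by linarith) (hballR hεy.2)
  intro ε x hε hx hxr hxΩ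
  have hεR : |ε - ε₀| < R := by linarith
  have hxR := hballR hxr
  obtain ⟨-, -, hchc⟩ := hsol ε (e x) (hRW ε _ hεR hxR)
  have hxgood := hR₀sub (hRR₀ hxR)
  have hxV : x ∈ V := by
    have := hxgood.1.2
    rwa [e.left_inv hx] at this
  have hFx : F (e x) ≤ 0 := by
    rw [hxgood.2.1, e.left_inv hx]
    exact hdef.nonpos hxV hxΩ
  obtain ⟨hφx, γ, u, hγ0, hγ0A, hγx, hγs, hu, hγ⟩ := hchc hFx
  refine ⟨hφx, le_antisymm ?_ ?_⟩
  · set τ := φ (ε, e x) with hτ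
    have hz0 := hR₀sub hγ0A
    have hfz : f (e.symm (γ 0)) = 0 := by rw [← hz0.2.1, hγ0]
    -- The foot is a limit of points of the characteristic with `f < 0`, or equals `x` if the time
    -- is zero. Together with `f = 0` this puts it on `∂Ω`.
    have hzΩ : e.symm (γ 0) ∈ closure Ω := by
      rcases hφx.eq_or_lt with h0 | hpos
      · rw [h0, hγx, e.left_inv hx]
        exact hxΩ
      · have hcont : ContinuousWithinAt (fun t => e.symm (γ t)) (Ioc 0 τ) 0 := by
          refine ContinuousAt.comp_continuousWithinAt (f := γ)
            (e.continuousAt_symm hz0.1.1) ?_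
          exact (hγs.continuousOn 0 ⟨le_rfl, hφx⟩).mono Ioc_subset_Icc_self
        refine hcont.mem_closure ?_ fun t ht => ?_
        · rw [closure_Ioc hpos.ne]
          exact ⟨le_rfl, hφx⟩
        · obtain ⟨h1, -, -, h2⟩ := hγ t (Ioc_subset_Icc_self ht)
          have h3 := hR₀sub h1
          rw [hdef.mem_iff h3.1.2, ← h3.2.1]
          exact h2 ht.1
    have hzfr := hdef.mem_frontier hΩ hz0.1.2 hfz hzΩ
    have hle := frameEDist_le_of_chart_curve (X := variationFrame X Y ε) p hφx (c := γ) (u := u)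
      (fun t ht => (hR₀sub (hγ t ht).1).1.1) hγs hu (fun t ht => by
        obtain ⟨h1, h2, -⟩ := hγ t ht
        simp_rw [hZcoord _ h1] at h2
        exact h2) (fun t ht => (hγ t ht).2.2.1)
    refine (iInf₂_le _ hzfr).trans ?_
    rwa [← he, hγx, e.left_inv hx] at hle
  · have hslice : ContDiffOn ℝ 1 (fun y => φ (ε, y)) (Metric.ball y₀ R) :=
      (hφ.comp (contDiffOn_const.prodMk contDiffOn_id) fun y hy => hRW ε y hεR hy).of_le (by simp)
    refine ofReal_le_edistFrom (X := variationFrame X Y ε) p hR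
      (fun y hy => (hR₀sub (hRR₀ hy)).1.1) hslice (fun y hy => ?_)
      (hχ.contDiffOn.of_le (by simp)) hC (fun y hy => ?_) (fun y hy => ?_)
      (fun z hz hze hzR => ?_) hx ?_ ?_ ?_
    · have h1 := (hsol ε y (hRW ε y hεR hy)).1
      simp_rw [hZcoord y (hRR₀ hy)] at h1
      exact h1.le
    · have h1 : (ε, y) ∈ Metric.closedBall (ε₀, y₀) R := by
        rw [← closedBall_prod_same]
        exact ⟨by simpa [Real.dist_eq] using hεR.le, Metric.ball_subset_closedBall hy⟩
      have h2 := hC₀ _ h1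
      rw [Real.norm_eq_abs] at h2
      have h3 : gradSq Z χ (ε, y) ≤ C ^ 2 := by
        have h4 : 0 ≤ |C₀| := abs_nonneg _
        have h5 : gradSq Z χ (ε, y) ≤ |C₀| := (le_abs_self _).trans (h2.trans (le_abs_self _))
        rw [hCdef]
        nlinarith
      simp only [gradSq, hZcoord y (hRR₀ hy)] at h3
      exact h3
    · exact χ.zero_of_le_dist (not_lt.1 hy)
    · have h1 := hR₀sub (hRR₀ hzR)
      refine (hsol ε _ (hRW ε _ hεR hzR)).2.1 ?_
      have h2 := h1.1.2
      rw [h1.2.1]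
      rw [← he, e.left_inv hze] at h2 ⊢
      exact hdef.eq_zero hΩ h2 hz
    · exact Metric.ball_subset_ball (by linarith) hxr
    · exact χ.one_of_mem_closedBall
        (Metric.ball_subset_closedBall (Metric.ball_subset_ball hrR hxr))
    · have h1 : (ε, e x) ∈ Metric.ball (ε₀, y₀) R₂ := by
        rw [← ball_prod_same]
        exact ⟨by simpa [Real.dist_eq] using hε.trans_le (min_le_right _ _),
          Metric.ball_subset_ball (min_le_right _ _) hxr⟩
      exact (hR₂sub h1).le

end LocalDistance

/-! ### Calculus on domains with boundary -/

section Calculus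

variable {E : Type*} [NormedAddCommGroup E] [NormedSpace ℝ E]

/-- The derivatives in `y` alone are the full derivatives restricted to the directions `(0, v)`. -/
lemma continuous_iteratedFDeriv_slice {F : Type*} [NormedAddCommGroup F] [NormedSpace ℝ F]
    {Ψ : ℝ × E → F} (hΨ : ContDiff ℝ ∞ Ψ) (k : ℕ) :
    Continuous fun a : ℝ × E => iteratedFDeriv ℝ k (fun y => Ψ (a.1, y)) a.2 := by
  have h : ∀ a : ℝ × E, iteratedFDeriv ℝ k (fun y => Ψ (a.1, y)) a.2 =
      ContinuousMultilinearMap.compContinuousLinearMapL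
        (fun _ : Fin k => ContinuousLinearMap.inr ℝ ℝ E) (iteratedFDeriv ℝ k Ψ a) := by
    rintro ⟨ε, y⟩
    have h1 : (fun y => Ψ (ε, y)) =
        (fun z => Ψ ((ε, 0) + z)) ∘ ContinuousLinearMap.inr ℝ ℝ E := by
      funext z
      simp
    have h2 : ContDiff ℝ ∞ fun z => Ψ ((ε, 0) + z) := hΨ.comp (contDiff_const.add contDiff_id)
    simp only
    rw [h1, ContinuousLinearMap.iteratedFDeriv_comp_right _ h2 y
      (i := k) (by exact_mod_cast le_top), iteratedFDeriv_comp_add_left]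
    simp
  simp_rw [h]
  exact (ContinuousLinearMap.continuous _).comp
    (hΨ.continuous_iteratedFDeriv (m := k) (by exact_mod_cast le_top))

/-- The tangent cone contains the open half-space `{L < 0}`, which spans: any `w` is a difference of
two of its vectors, `w + c • v` and `c • v` with `c` large. -/
lemma uniqueDiffWithinAt_of_sublevel {g : E → ℝ} {L : E →L[ℝ] ℝ} {y : E} {S : Set E}
    (hg : HasFDerivAt g L y) (hL : L ≠ 0) (hgy : g y = 0) (hyS : y ∈ S)
    (hS : ∀ᶠ z in 𝓝 y, g z < 0 → z ∈ S) : UniqueDiffWithinAt ℝ S y := by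
  have hcone : ∀ v, L v < 0 → v ∈ tangentConeAt ℝ S y := by
    intro v hv
    have hline : HasDerivAt (fun t : ℝ => g (y + t • v)) (L v) 0 := by
      have h1 : HasDerivAt (fun t : ℝ => y + t • v) v 0 := by
        simpa using ((hasDerivAt_id (0 : ℝ)).smul_const v).const_add y
      have h2 : HasFDerivAt g L (y + (0 : ℝ) • v) := by simpa using hg
      exact h2.comp_hasDerivAt 0 h1
    have hneg : ∀ᶠ t in 𝓝[>] (0 : ℝ), g (y + t • v) < 0 := by
      have h1 := (hasDerivAt_iff_tendsto_slope.1 hline).eventually_lt_const hv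
      have h2 : ∀ᶠ t in 𝓝[>] (0 : ℝ), slope (fun t : ℝ => g (y + t • v)) 0 t < 0 :=
        h1.filter_mono (nhdsWithin_mono _ fun t (ht : 0 < t) => ht.ne')
      filter_upwards [h2, self_mem_nhdsWithin] with t ht (ht0 : 0 < t)
      simp only [slope, zero_smul, add_zero, hgy, vsub_eq_sub, sub_zero, smul_eq_mul] at ht
      exact (pos_iff_neg_of_mul_neg ht).1 (inv_pos.2 ht0)
    have hlim : Tendsto (fun t : ℝ => y + t • v) (𝓝[>] 0) (𝓝 y) := by
      have : Continuous fun t : ℝ => y + t • v := by fun_prop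
      simpa using (this.tendsto 0).mono_left nhdsWithin_le_nhds
    refine mem_tangentConeAt_of_add_smul_mem (l := 𝓝[>] (0 : ℝ)) (c := fun t => t) ?_ ?_
    · exact tendsto_nhdsWithin_mono_right (fun t (ht : 0 < t) => ht.ne')
        tendsto_id
    · filter_upwards [hneg, hlim.eventually hS] with t h1 h2
      exact h2 h1
  refine ⟨?_, subset_closure hyS⟩
  obtain ⟨v, hv⟩ : ∃ v, L v < 0 := by
    obtain ⟨v, hv⟩ : ∃ v, L v ≠ 0 := by
      by_contra! h
      exact hL (ContinuousLinearMap.ext h)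
    rcases lt_or_gt_of_ne hv with h | h
    · exact ⟨v, h⟩
    · exact ⟨-v, by simpa using h⟩
  have htop : Submodule.span ℝ (tangentConeAt ℝ S y) = ⊤ := by
    refine eq_top_iff.2 fun w _ => ?_
    obtain ⟨c, hc, hcw⟩ : ∃ c : ℝ, 0 < c ∧ L (w + c • v) < 0 := by
      refine ⟨|L w| / (-L v) + 1, ?_, ?_⟩
      · have := div_nonneg (abs_nonneg (L w)) (neg_pos.2 hv).le
        linarith
      · rw [map_add, map_smul, smul_eq_mul, add_mul, one_mul]
        have h1 : |L w| / (-L v) * L v = -|L w| := by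
          rw [div_neg, neg_mul, div_mul_cancel₀ _ hv.ne]
        rw [h1]
        linarith [le_abs_self (L w)]
    have : w = (w + c • v) - c • v := by abel
    rw [this]
    exact Submodule.sub_mem _ (Submodule.subset_span (hcone _ hcw))
      (Submodule.smul_mem _ _ (Submodule.subset_span (hcone _ hv)))
  rw [htop]
  exact dense_univ

end Calculus

/-! ### The frame `X` as the member `ε = 0` of its variation -/

section ZeroVariation

variable {E : Type*} [NormedAddCommGroup E] [NormedSpace ℝ E]
variable {M : Type*} [TopologicalSpace M] [ChartedSpace E M]
variable {ι κ : Type*} [Fintype ι] [Fintype κ]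
variable (X : ι → (x : M) → TangentSpace 𝓘(ℝ, E) x) (Y : κ → (x : M) → TangentSpace 𝓘(ℝ, E) x)

lemma sum_smul_variationFrame_zero (u : ι ⊕ κ → ℝ) (x : M) :
    ∑ k, u k • variationFrame X Y 0 k x = ∑ i, u (Sum.inl i) • X i x := by
  simp [Fintype.sum_sum_type, variationFrame]

lemma bddBelow_sum_sq_control (x : M) (v : TangentSpace 𝓘(ℝ, E) x) :
    BddBelow {s : ℝ | ∃ u : ι → ℝ, ∑ i, u i • X i x = v ∧ s = ∑ i, u i ^ 2} := by
  refine ⟨0, ?_⟩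
  rintro _ ⟨u, -, rfl⟩
  exact Finset.sum_nonneg fun i _ => sq_nonneg _

/-- The additional controls multiply zero fields, so discarding them keeps the vector and does not
raise the cost. Outside the distribution both sets are empty and the default infima agree. -/
lemma frameNorm_variationFrame_zero (x : M) (v : TangentSpace 𝓘(ℝ, E) x) :
    frameNorm (variationFrame X Y 0) x v = frameNorm X x v := by
  have hsub : {s : ℝ | ∃ u : ι → ℝ, ∑ i, u i • X i x = v ∧ s = ∑ i, u i ^ 2} ⊆
      {s : ℝ | ∃ u : ι ⊕ κ → ℝ,
        ∑ i, u i • variationFrame X Y 0 i x = v ∧ s = ∑ i, u i ^ 2} := by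
    rintro _ ⟨u, hu, rfl⟩
    refine ⟨Sum.elim u 0, ?_, by simp [Fintype.sum_sum_type]⟩
    rw [sum_smul_variationFrame_zero]
    simpa using hu
  unfold frameNorm
  congr 1
  rcases eq_empty_or_nonempty {s : ℝ | ∃ u : ι ⊕ κ → ℝ,
      ∑ i, u i • variationFrame X Y 0 i x = v ∧ s = ∑ i, u i ^ 2} with h | h
  · rw [h, subset_empty_iff.1 (hsub.trans h.subset)]
  · have hmaj : ∀ s ∈ {s : ℝ | ∃ u : ι ⊕ κ → ℝ,
        ∑ i, u i • variationFrame X Y 0 i x = v ∧ s = ∑ i, u i ^ 2},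
        ∃ s' ∈ {s : ℝ | ∃ u : ι → ℝ, ∑ i, u i • X i x = v ∧ s = ∑ i, u i ^ 2}, s' ≤ s := by
      rintro _ ⟨u, hu, rfl⟩
      refine ⟨_, ⟨u ∘ Sum.inl, ?_, rfl⟩, ?_⟩
      · rw [sum_smul_variationFrame_zero] at hu
        exact hu
      · rw [Fintype.sum_sum_type]
        exact le_add_of_nonneg_right (Finset.sum_nonneg fun i _ => sq_nonneg _)
    refine le_antisymm ?_ (le_csInf h fun s hs => ?_)
    · obtain ⟨s, hs⟩ := h
      obtain ⟨s', hs', -⟩ := hmaj s hs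
      exact csInf_le_csInf (bddBelow_sum_sq_control _ x v) ⟨s', hs'⟩ hsub
    · obtain ⟨s', hs', hle⟩ := hmaj s hs
      exact (csInf_le (bddBelow_sum_sq_control _ x v) hs').trans hle

lemma isHorizontalCurve_variationFrame_zero_iff {T : ℝ} {γ : ℝ → M} :
    IsHorizontalCurve (variationFrame X Y 0) T γ ↔ IsHorizontalCurve X T γ := by
  constructor
  · rintro ⟨hac, u, hu, hγ⟩
    refine ⟨hac, fun t i => u t (Sum.inl i), fun i => hu (Sum.inl i), ?_⟩
    filter_upwards [hγ] with t ht
    rwa [sum_smul_variationFrame_zero] at ht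
  · rintro ⟨hac, u, hu, hγ⟩
    refine ⟨hac, fun t => Sum.elim (u t) 0, ?_, ?_⟩
    · rintro (i | j)
      · exact hu i
      · exact MemLp.zero
    · filter_upwards [hγ] with t ht
      rw [sum_smul_variationFrame_zero]
      exact ht

lemma edistFrom_variationFrame_zero (S : Set M) (x : M) :
    edistFrom (variationFrame X Y 0) S x = edistFrom X S x := by
  simp only [edistFrom, frameEDist, curveLength, frameNorm_variationFrame_zero,
    isHorizontalCurve_variationFrame_zero_iff]

lemma distFrom_variationFrame_zero (S : Set M) :
    distFrom (variationFrame X Y 0) S = distFrom X S :=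
  funext fun x => congrArg ENNReal.toReal (edistFrom_variationFrame_zero X Y S x)

end ZeroVariation

/-! ### Smoothness and convergence of the distance functions near the boundary -/

section Smoothness

variable {E : Type*} [NormedAddCommGroup E] [NormedSpace ℝ E]
variable {M : Type*} [TopologicalSpace M] [ChartedSpace E M]
variable {ι κ : Type*} [Fintype ι] [Fintype κ]

/-- Near the parameter `ε₁` and the point `x`, the distance from `∂Ω` is finite on `closure Ω` and
is given in a chart by a function that is smooth in the parameter and the point. -/
def HasSmoothDistNear (X : ι → (x : M) → TangentSpace 𝓘(ℝ, E) x)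
    (Y : κ → (x : M) → TangentSpace 𝓘(ℝ, E) x) (Ω : Set M) (ε₁ : ℝ) (x : M) : Prop :=
  ∃ (p : M) (φ : ℝ × E → ℝ) (O : Set (ℝ × E)), x ∈ (chartAt E p).source ∧ IsOpen O ∧
    (ε₁, chartAt E p x) ∈ O ∧ ContDiffOn ℝ ∞ φ O ∧
    ∀ ε z, z ∈ (chartAt E p).source → (ε, chartAt E p z) ∈ O → z ∈ closure Ω →
      0 ≤ φ (ε, chartAt E p z) ∧ edistFrom (variationFrame X Y ε) (frontier Ω) z =
        ENNReal.ofReal (φ (ε, chartAt E p z))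

variable {X : ι → (x : M) → TangentSpace 𝓘(ℝ, E) x} {Y : κ → (x : M) → TangentSpace 𝓘(ℝ, E) x}
variable {Ω : Set M} {ε₁ : ℝ} {x : M}

lemma HasSmoothDistNear.edistFrom_ne_top (h : HasSmoothDistNear X Y Ω ε₁ x)
    (hx : x ∈ closure Ω) : edistFrom (variationFrame X Y ε₁) (frontier Ω) x ≠ ⊤ := by
  obtain ⟨p, φ, O, hxp, -, hxO, -, hdist⟩ := h
  rw [(hdist ε₁ x hxp hxO hx).2]
  exact ENNReal.ofReal_ne_top

/-- This makes derivatives within the domain well determined up to the boundary, so that they can be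
computed from any smooth extension. -/
lemma HasSmoothBoundary.uniqueDiffOn_coord (hbd : HasSmoothBoundary E Ω) (hΩ : IsOpen Ω)
    {V : Set M} (hV : IsOpen V) {e : OpenPartialHomeomorph M E}
    (he : e ∈ IsManifold.maximalAtlas 𝓘(ℝ, E) ∞ M) :
    UniqueDiffOn ℝ (e.target ∩ e.symm ⁻¹' (V ∩ closure Ω)) := by
  rintro y ⟨hyt, hyV, hyΩ⟩
  by_cases hy : e.symm y ∈ Ω
  · have hO : IsOpen (e.target ∩ e.symm ⁻¹' (V ∩ Ω)) := e.isOpen_inter_preimage_symm (hV.inter hΩ)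
    refine uniqueDiffWithinAt_of_mem_nhds (mem_of_superset (hO.mem_nhds ⟨hyt, hyV, hy⟩) ?_)
    exact fun z hz => ⟨hz.1, hz.2.1, subset_closure hz.2.2⟩
  have hfr : e.symm y ∈ frontier Ω := by
    rw [hΩ.frontier_eq]
    exact ⟨hyΩ, hy⟩
  obtain ⟨W, f, hdef⟩ := hbd _ hfr
  have hO : IsOpen (e.target ∩ e.symm ⁻¹' (W ∩ V)) :=
    e.isOpen_inter_preimage_symm (hdef.isOpen.inter hV)
  have hmem : y ∈ e.target ∩ e.symm ⁻¹' (W ∩ V) := ⟨hyt, hdef.mem, hyV⟩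
  have hsmooth : ContDiffOn ℝ ∞ (f ∘ e.symm) (e.target ∩ e.symm ⁻¹' (W ∩ V)) :=
    (hdef.smooth.comp ((contMDiffOn_symm_of_mem_maximalAtlas he).mono inter_subset_left)
      fun z hz => hz.2.1).contDiffOn
  have hder : HasFDerivAt (f ∘ e.symm) (fderiv ℝ (f ∘ e.symm) y) y :=
    ((hsmooth.contDiffAt (hO.mem_nhds hmem)).differentiableAt (by simp)).hasFDerivAt
  refine uniqueDiffWithinAt_of_sublevel hder (fun h0 => hdef.mfderiv_ne_zero ?_)
    (hdef.eq_zero hΩ hdef.mem hfr) ⟨hyt, hyV, hyΩ⟩ ?_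
  · have hxs : e.symm y ∈ e.source := e.map_target hyt
    have h1 : HasMFDerivAt 𝓘(ℝ, E) 𝓘(ℝ, ℝ) (f ∘ e.symm) (e (e.symm y)) (0 : E →L[ℝ] ℝ) := by
      rw [e.right_inv hyt, ← h0]
      exact hasMFDerivAt_iff_hasFDerivAt.2 hder
    have h2 := h1.comp (e.symm y)
      ((contMDiffAt_of_mem_maximalAtlas he hxs).mdifferentiableAt (by simp)).hasMFDerivAt
    have h3 : f =ᶠ[𝓝 (e.symm y)] (f ∘ e.symm) ∘ e := by
      filter_upwards [e.open_source.mem_nhds hxs] with z hz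
      simp [e.left_inv hz]
    rw [(h2.congr_of_eventuallyEq h3).mfderiv]
    exact ContinuousLinearMap.zero_comp _
  · filter_upwards [hO.mem_nhds hmem] with z hz hfz
    exact ⟨hz.1, hz.2.2, subset_closure ((hdef.mem_iff hz.2.1).2 hfz)⟩

variable [IsManifold 𝓘(ℝ, E) ∞ M]

lemma HasSmoothDistNear.exists_coord_expr (h : HasSmoothDistNear X Y Ω ε₁ x)
    {e : OpenPartialHomeomorph M E} (he : e ∈ IsManifold.maximalAtlas 𝓘(ℝ, E) ∞ M)
    (hx : x ∈ e.source) :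
    ∃ (ψ : ℝ × E → ℝ) (O : Set (ℝ × E)), IsOpen O ∧ (ε₁, e x) ∈ O ∧ ContDiffOn ℝ ∞ ψ O ∧
      ∀ a ∈ O, e.symm a.2 ∈ closure Ω →
        distFrom (variationFrame X Y a.1) (frontier Ω) (e.symm a.2) = ψ a := by
  obtain ⟨p, φ, O, hxp, hO, hxO, hφ, hdist⟩ := h
  set c := chartAt E p
  have hD : IsOpen (e.target ∩ e.symm ⁻¹' c.source) := e.isOpen_inter_preimage_symm c.open_source
  have htrans : ContDiffOn ℝ ∞ (c ∘ e.symm) (e.target ∩ e.symm ⁻¹' c.source) :=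
    ((contMDiffOn_chart (n := ∞) (x := p)).comp
      ((contMDiffOn_symm_of_mem_maximalAtlas he).mono inter_subset_left)
      fun y hy => hy.2).contDiffOn
  have hmap : ContDiffOn ℝ ∞ (fun a : ℝ × E => (a.1, (c ∘ e.symm) a.2))
      (Prod.snd ⁻¹' (e.target ∩ e.symm ⁻¹' c.source)) :=
    contDiffOn_fst.prodMk (htrans.comp contDiffOn_snd fun a ha => ha)
  refine ⟨fun a => φ (a.1, c (e.symm a.2)),
    Prod.snd ⁻¹' (e.target ∩ e.symm ⁻¹' c.source) ∩
      (fun a : ℝ × E => (a.1, (c ∘ e.symm) a.2)) ⁻¹' O,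
    hmap.continuousOn.isOpen_inter_preimage (hD.preimage continuous_snd) hO, ?_, ?_, ?_⟩
  · refine ⟨⟨e.map_source hx, ?_⟩, ?_⟩
    · simpa [e.left_inv hx] using hxp
    · simpa [e.left_inv hx] using hxO
  · exact hφ.comp (hmap.mono inter_subset_left) fun a ha => ha.2
  · rintro ⟨ε, y⟩ ⟨⟨-, hyc⟩, hyO⟩ hyΩ
    obtain ⟨h0, h1⟩ := hdist ε (e.symm y) hyc hyO hyΩ
    rw [distFrom, h1, ENNReal.toReal_ofReal h0]

lemma HasSmoothDistNear.contMDiffWithinAt (h : HasSmoothDistNear X Y Ω ε₁ x)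
    (hx : x ∈ closure Ω) : ContMDiffWithinAt 𝓘(ℝ, E) 𝓘(ℝ, ℝ) ∞
      (distFrom (variationFrame X Y ε₁) (frontier Ω)) (closure Ω) x := by
  obtain ⟨ψ, O, hO, hxO, hψ, hdist⟩ := h.exists_coord_expr
    (IsManifold.chart_mem_maximalAtlas x) (mem_chart_source E x)
  set c := chartAt E x
  have hxc : x ∈ c.source := mem_chart_source E x
  have hψ' : ContDiffAt ℝ ∞ (fun y => ψ (ε₁, y)) (c x) :=
    (hψ.contDiffAt (hO.mem_nhds hxO)).comp (c x) (contDiffAt_const.prodMk contDiffAt_id)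
  have hcomp : ContMDiffAt 𝓘(ℝ, E) 𝓘(ℝ, ℝ) ∞ (fun z => ψ (ε₁, c z)) x :=
    hψ'.contMDiffAt.comp x ((contMDiffOn_chart (n := ∞) (x := x)).contMDiffAt
      (c.open_source.mem_nhds hxc))
  have hpair : ContinuousAt (fun z => (ε₁, c z)) x :=
    continuousAt_const.prodMk (c.continuousAt hxc)
  have heq : ∀ᶠ z in 𝓝 x, z ∈ closure Ω →
      distFrom (variationFrame X Y ε₁) (frontier Ω) z = ψ (ε₁, c z) := by
    filter_upwards [c.open_source.mem_nhds hxc, hpair.eventually (hO.mem_nhds hxO)] with z hz hzO hzΩ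
    have := hdist _ hzO
    simp only [c.left_inv hz] at this
    exact this hzΩ
  refine hcomp.contMDiffWithinAt.congr_of_eventuallyEq (eventually_nhdsWithin_iff.2 heq)
    (heq.self_of_nhds hx)

/-- In coordinates the distances are restrictions of the slices of one smooth `Ψ (ε, y)`; their
derivatives within the domain are those of the slices, which are jointly continuous. This gives
locally uniform convergence, and compactness of `K` does the rest. -/
lemma tendstoWithAllDerivatives_distFrom [FiniteDimensional ℝ E]
    (hbd : HasSmoothBoundary E Ω) (hΩ : IsOpen Ω) {V : Set M} (hV : IsOpen V)
    (hdist : ∀ x ∈ V, HasSmoothDistNear X Y Ω 0 x) :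
    TendstoWithAllDerivatives E
      (fun ε : ℝ => distFrom (variationFrame X Y ε) (frontier Ω)) (distFrom X (frontier Ω))
      (𝓝 0) (V ∩ closure Ω) := by
  intro e he k K hK hKU
  rw [← tendstoLocallyUniformlyOn_iff_tendstoUniformlyOn_of_compact
    (hK.image_of_continuousOn (e.continuousOn.mono fun x hx => (hKU hx).2)),
    Metric.tendstoLocallyUniformlyOn_iff]
  rintro η hη _ ⟨x, hxK, rfl⟩
  obtain ⟨⟨hxV, hxΩ⟩, hxe⟩ := hKU hxK
  set S := e.target ∩ e.symm ⁻¹' (V ∩ closure Ω) with hS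
  have hSu : UniqueDiffOn ℝ S := hbd.uniqueDiffOn_coord hΩ hV he
  obtain ⟨ψ, O, hO, hxO, hψ, hdψ⟩ := (hdist x hxV).exists_coord_expr he hxe
  obtain ⟨Ψ, hΨ, hΨψ⟩ := exists_contDiff_eventuallyEq hO hψ hxO
  have hcoord : ∀ᶠ a in 𝓝 ((0 : ℝ), e x), a.2 ∈ S →
      distFrom (variationFrame X Y a.1) (frontier Ω) (e.symm a.2) = Ψ a := by
    filter_upwards [hO.mem_nhds hxO, hΨψ] with a ha haΨ haS
    rw [hdψ a ha haS.2.2, haΨ]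
  have hder : ∀ᶠ a in 𝓝 ((0 : ℝ), e x), a.2 ∈ S →
      iteratedFDerivWithin ℝ k
        (distFrom (variationFrame X Y a.1) (frontier Ω) ∘ e.symm) S a.2 =
      iteratedFDeriv ℝ k (fun y => Ψ (a.1, y)) a.2 := by
    filter_upwards [eventually_eventually_nhds.2 hcoord] with a ha haS
    have hslice : ∀ᶠ y in 𝓝 a.2, y ∈ S →
        distFrom (variationFrame X Y a.1) (frontier Ω) (e.symm y) = Ψ (a.1, y) :=
      (Continuous.prodMk_right a.1).continuousAt (x := a.2) |>.eventually ha
    have heq : distFrom (variationFrame X Y a.1) (frontier Ω) ∘ e.symm =ᶠ[𝓝[S] a.2]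
        fun y => Ψ (a.1, y) := eventually_nhdsWithin_iff.2 hslice
    rw [heq.iteratedFDerivWithin_eq (hslice.self_of_nhds haS) k]
    refine iteratedFDerivWithin_eq_iteratedFDeriv hSu ?_ haS
    exact ((hΨ.comp (contDiff_const.prodMk contDiff_id)).of_le
      (by exact_mod_cast le_top)).contDiffAt
  -- Projection to the slice `ε = 0`, so that `hder` also computes the derivatives of the limit at
  -- the same point.
  have hzero : ContinuousAt (fun a : ℝ × E => ((0 : ℝ), a.2)) ((0 : ℝ), e x) := by fun_prop
  have hcont : Continuous fun a : ℝ × E =>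
      dist (iteratedFDeriv ℝ k (fun y => Ψ (0, y)) a.2)
        (iteratedFDeriv ℝ k (fun y => Ψ (a.1, y)) a.2) := by
    have h := continuous_iteratedFDeriv_slice hΨ k
    exact (h.comp (continuous_const.prodMk continuous_snd)).dist h
  have hclose : ∀ᶠ a in 𝓝 ((0 : ℝ), e x), a.2 ∈ S →
      dist (iteratedFDerivWithin ℝ k (distFrom X (frontier Ω) ∘ e.symm) S a.2)
        (iteratedFDerivWithin ℝ k
          (distFrom (variationFrame X Y a.1) (frontier Ω) ∘ e.symm) S a.2) < η := by
    filter_upwards [hder, hzero.eventually hder,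
      hcont.continuousAt.eventually_lt_const (by simpa using hη)] with a h1 h2 h3 haS
    rw [h1 haS, ← distFrom_variationFrame_zero X Y, h2 haS]
    exact h3
  rw [nhds_prod_eq, eventually_prod_iff] at hclose
  obtain ⟨I, hI, B, hB, hIB⟩ := hclose
  have hKS : e '' K ⊆ S := by
    rintro _ ⟨z, hz, rfl⟩
    exact ⟨e.map_source (hKU hz).2, by
      rw [mem_preimage, e.left_inv (hKU hz).2]; exact (hKU hz).1⟩
  refine ⟨{y | B y} ∩ e '' K, inter_mem (mem_nhdsWithin_of_mem_nhds hB) self_mem_nhdsWithin, ?_⟩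
  filter_upwards [hI] with ε hε y hy
  exact hIB hε hy.1 (hKS hy.2)

/-- Each parameter has a product neighbourhood of `(p, ε₀)` on which the local description holds;
compactness of `J` leaves one neighbourhood of `p`. -/
lemma eventually_hasSmoothDistNear [FiniteDimensional ℝ E] [T2Space M]
    (hX : ∀ i, IsSmoothField (X i)) (hY : ∀ j, IsSmoothField (Y j))
    (hΩ : IsOpen Ω) (hbd : HasSmoothBoundary E Ω) {p : M} (hp : p ∈ frontier Ω)
    (hchar : ¬ IsCharacteristicPoint X Ω p) {J : Set ℝ} (hJ : IsCompact J) :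
    ∀ᶠ x in 𝓝 p, ∀ ε ∈ J, HasSmoothDistNear X Y Ω ε x := by
  refine hJ.eventually_forall_of_forall_eventually fun ε₀ _ => ?_
  obtain ⟨r, hr, φ, hball, hφ, hdist⟩ := exists_local_distance hX hY hΩ hbd hp hchar ε₀
  set c := chartAt E p
  have hpc : p ∈ c.source := mem_chart_source E p
  have hsrc : ∀ᶠ a : M × ℝ in 𝓝 (p, ε₀), a.1 ∈ c.source :=
    continuousAt_fst.eventually (c.open_source.mem_nhds hpc)
  have hpair : ContinuousAt (fun a : M × ℝ => (a.2, c a.1)) (p, ε₀) :=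
    continuousAt_snd.prodMk ((c.continuousAt hpc).comp (x := (p, ε₀)) continuousAt_fst)
  filter_upwards [hsrc, hpair.eventually (Metric.ball_mem_nhds _ hr)] with a ha haO
  refine ⟨p, φ, Metric.ball (ε₀, c p) r, ha, Metric.isOpen_ball, haO, hφ, ?_⟩
  intro ε z hz hzO hzΩ
  rw [← ball_prod_same] at hzO
  exact hdist ε z (by simpa [Real.dist_eq] using hzO.1) hz hzO.2 hzΩ

end Smoothness

end SubRiem

end

theorem lemma6p1
    {E : Type*} [NormedAddCommGroup E] [NormedSpace ℝ E] [FiniteDimensional ℝ E]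
    {M : Type*} [TopologicalSpace M] [T2Space M] [SecondCountableTopology M] [ConnectedSpace M]
    [ChartedSpace E M] [IsManifold 𝓘(ℝ, E) ∞ M]
    {N L : ℕ}
    (X : Fin N → (x : M) → TangentSpace 𝓘(ℝ, E) x) (hX : SubRiem.IsSubRiemannianFrame X)
    (Y : Fin L → (x : M) → TangentSpace 𝓘(ℝ, E) x) (hY : SubRiem.IsRiemannianFrame Y)
    (Ω : Set M) (hΩ : IsOpen Ω) (hΩc : IsCompact (closure Ω))
    (hbd : SubRiem.HasSmoothBoundary E Ω)
    (hchar : ∀ p ∈ frontier Ω, ¬ SubRiem.IsCharacteristicPoint X Ω p)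
    (εbar : ℝ) (hεbar : 0 < εbar) :
    ∃ (V U : Set M), IsOpen V ∧ frontier Ω ⊆ V ∧ U = V ∩ closure Ω ∧
      ((∀ x ∈ U, SubRiem.edistFrom X (frontier Ω) x ≠ ⊤) ∧
        ContMDiffOn 𝓘(ℝ, E) 𝓘(ℝ, ℝ) ∞ (SubRiem.distFrom X (frontier Ω)) U) ∧
      (∀ ε : ℝ, |ε| < εbar →
        (∀ x ∈ U, SubRiem.edistFrom (SubRiem.variationFrame X Y ε) (frontier Ω) x ≠ ⊤) ∧
        ContMDiffOn 𝓘(ℝ, E) 𝓘(ℝ, ℝ) ∞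
          (SubRiem.distFrom (SubRiem.variationFrame X Y ε) (frontier Ω)) U) ∧
      SubRiem.TendstoWithAllDerivatives E
        (fun ε : ℝ => SubRiem.distFrom (SubRiem.variationFrame X Y ε) (frontier Ω))
        (SubRiem.distFrom X (frontier Ω)) (𝓝[≠] 0) U := by
  have hIcc : ∀ ε : ℝ, |ε| < εbar → ε ∈ Icc (-εbar) εbar := fun ε hε =>
    ⟨(abs_lt.1 hε).1.le, (abs_lt.1 hε).2.le⟩
  -- The closed interval is taken so that compactness applies; it makes `G` a neighbourhood of each
  -- boundary point.
  set G : Set M := {x | ∀ ε ∈ Icc (-εbar) εbar, SubRiem.HasSmoothDistNear X Y Ω ε x} with hG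
  have hdist : ∀ x ∈ interior G, ∀ ε : ℝ, |ε| < εbar → SubRiem.HasSmoothDistNear X Y Ω ε x :=
    fun x hx ε hε => interior_subset hx ε (hIcc ε hε)
  have hvar : ∀ ε : ℝ, |ε| < εbar →
      (∀ x ∈ interior G ∩ closure Ω,
        SubRiem.edistFrom (SubRiem.variationFrame X Y ε) (frontier Ω) x ≠ ⊤) ∧
      ContMDiffOn 𝓘(ℝ, E) 𝓘(ℝ, ℝ) ∞
        (SubRiem.distFrom (SubRiem.variationFrame X Y ε) (frontier Ω)) (interior G ∩ closure Ω) :=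
    fun ε hε => ⟨fun x hx => (hdist x hx.1 ε hε).edistFrom_ne_top hx.2,
      fun x hx => ((hdist x hx.1 ε hε).contMDiffWithinAt hx.2).mono inter_subset_right⟩
  have habs : |(0 : ℝ)| < εbar := by simpa using hεbar
  refine ⟨interior G, interior G ∩ closure Ω, isOpen_interior, fun p hp => ?_, rfl, ?_, hvar, ?_⟩
  · exact mem_interior_iff_mem_nhds.2 (SubRiem.eventually_hasSmoothDistNear hX.smooth hY.smooth
      hΩ hbd hp (hchar p hp) isCompact_Icc)
  · simpa only [SubRiem.edistFrom_variationFrame_zero, SubRiem.distFrom_variationFrame_zero]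
      using hvar 0 habs
  · intro e he k K hK hKU u hu
    exact nhdsWithin_le_nhds (SubRiem.tendstoWithAllDerivatives_distFrom hbd hΩ isOpen_interior
      (fun x hx => hdist x hx 0 habs) e he k K hK hKU u hu)
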